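/- **Setting.** Let $S$ be a unital inverse semigroup with unit $e$; $s^*$ denotes the generalized inverse of $s$. A *Busby–Smith twisted action* $(A,S,\alpha,u)$ consists of a $C^*$-algebra $A$ and, for all $s,t\in S$, a closed two-sided ideal $A_s$ of $A$, an isomorphism of $C^*$-algebras $\alpha_s:A_{s^*}\to A_s$ and a unitary multiplier $u_{s,t}\in M(A_{st})$ such that for all $r,s,t\in S$: (a) $A_e=A$; (b) $\alpha_s\alpha_t=\mathrm{Ad}\,u_{s,t}\circ\alpha_{st}$ as partial maps (including equality of domains); (c) $u_{s,t}=1_{M(A_{st})}$ if $s$ or $t$ is idempotent; (d) $\alpha_r(a\,u_{s,t})\,u_{r,st}=\alpha_r(a)\,u_{r,s}\,u_{rs,t}$ for all $a\in A_{r^*}A_{st}$. An *$A$–$B$ imprimitivity bimodule* $X$ is an $A$–$B$-bimodule which is a full left Hilbert $A$-module and a full right Hilbert $B$-module with ${}_A\langle x,y\rangle\cdot z=x\cdot\langle y,z\rangle_B$. A closed subbimodule $Y$ is an imprimitivity bimodule over the ideals $\overline{\mathrm{span}}\,{}_A\langle Y,Y\rangle$ and $\overline{\mathrm{span}}\,\langle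 Y,Y\rangle_B$. A *partial automorphism* of $X$ is an isomorphism between two such subbimodules, that is, a triple consisting of $C^*$-isomorphisms of the left and of the right coefficient ideals and a surjective map of the subbimodules, compatible with both module actions and both inner products. Twisted actions $(A,S,\alpha,u)$ and $(B,S,\beta,v)$ are *Morita equivalent* if there are an $A$–$B$ imprimitivity bimodule $X$ with $A_s\cdot X=X\cdot B_s=:X_s$ for all $s\in S$, and maps $\phi_s:X_{s^*}\to X_s$, such that for all $s,t\in S$ the triple $(\alpha_s,\phi_s,\beta_s)$ is a partial automorphism of $X$ and $\phi_s\phi_t=u_{s,t}\cdot\phi_{st}(\cdot)\cdot v_{s,t}^*$ as partial maps. We then write $(A,S,\alpha,u)\sim_{X,\phi}(B,S,\beta,v)$. **Proposition.** For every unital inverse semigroup $S$, Morita equivalence is an equivalence relation on the Busby–Smith twisted actions of $S$. Moreover: 1. If $(A,S,\alpha,u)\sim_{X,\phi}(B,S,\beta,v)$, then $(B,S,\beta,v)\sim_{\tilde X,\tilde\phi}(A,S,\alpha,u)$, where $\tilde X=\{\tilde x:x\in X\}$ is the reverse bimodule, a conjugate-linear copy of $X$ with $b\cdot\tilde x=(x\cdot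 b^*)^{\sim}$, $\tilde x\cdot a=(a^*\cdot x)^{\sim}$, ${}_B\langle\tilde x,\tilde y\rangle=\langle x,y\rangle_B$, $\langle\tilde x,\tilde y\rangle_A={}_A\langle x,y\rangle$, and $\tilde\phi_s(\tilde x)=\phi_s(x)^{\sim}$ for $x\in X_{s^*}$. 2. If $(A,S,\alpha,u)\sim_{X,\phi}(B,S,\beta,v)\sim_{Y,\psi}(C,S,\gamma,w)$, then $(A,S,\alpha,u)\sim_{Z,\theta}(C,S,\gamma,w)$, where $Z=X\otimes_BY$ is the balanced tensor product (the completion of the algebraic tensor product for $\langle x_1\otimes y_1,x_2\otimes y_2\rangle_C=\langle y_1,\langle x_1,x_2\rangle_B\cdot y_2\rangle_C$, with $a\cdot(x\otimes y)=(a\cdot x)\otimes y$ and $(x\otimes y)\cdot c=x\otimes(y\cdot c)$), and $\theta_s=\phi_s\otimes\psi_s$, that is, $\theta_s(x\otimes y)=\phi_s(x)\otimes\psi_s(y)$ for $x\in X_{s^*}$, $y\in Y_{s^*}$. -/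

import Mathlib

open scoped MultiplierAlgebra

universe u v

/-- A unital inverse semigroup: a monoid in which every `s` has exactly one generalized inverse
`s⁻¹` (written `s*` on paper), i.e. exactly one `t` with `s t s = s` and `t s t = t`. -/
class InverseMonoid (S : Type v) extends Monoid S, Inv S where
  mul_inv_mul : ∀ s : S, s * s⁻¹ * s = s
  inv_mul_inv : ∀ s : S, s⁻¹ * s * s⁻¹ = s⁻¹
  inv_unique : ∀ s t : S, s * t * s = s → t * s * t = t → t = s⁻¹

/-- A closed two-sided ideal of a C⋆-algebra. (Closed two-sided ideals of C⋆-algebras are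
automatically stable under scalars and `star`; both are recorded here so that an ideal is a
C⋆-algebra by itself.) -/
structure ClosedIdeal (A : Type u) [NonUnitalCStarAlgebra A] where
  alg : NonUnitalStarSubalgebra ℂ A
  isClosed : IsClosed (alg : Set A)
  mul_mem_left : ∀ (a : A) {x : A}, x ∈ alg → a * x ∈ alg
  mul_mem_right : ∀ (a : A) {x : A}, x ∈ alg → x * a ∈ alg

instance ClosedIdeal.instMembership (A : Type u) [NonUnitalCStarAlgebra A] :
    Membership A (ClosedIdeal A) := ⟨fun I a => a ∈ I.alg⟩

/-- The ideal as a type (a C⋆-algebra). -/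
abbrev ClosedIdeal.Elem {A : Type u} [NonUnitalCStarAlgebra A] (I : ClosedIdeal A) : Type u :=
  I.alg

instance ClosedIdeal.instIsClosed {A : Type u} [NonUnitalCStarAlgebra A] (I : ClosedIdeal A) :
    IsClosed (I.alg : Set A) := I.isClosed

/-- The multiplier algebra `M(I)` of a closed ideal. -/
abbrev ClosedIdeal.Mult {A : Type u} [NonUnitalCStarAlgebra A] (I : ClosedIdeal A) : Type u :=
  𝓜(ℂ, I.Elem)

/-- The product `m a ∈ I` of a multiplier `m ∈ M(I)` and `a ∈ I`. -/
noncomputable def ClosedIdeal.mulLeft {A : Type u} [NonUnitalCStarAlgebra A] {I : ClosedIdeal A}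
    (m : I.Mult) (a : I.Elem) : I.Elem := m.fst a

/-- The product `a m ∈ I` of `a ∈ I` and a multiplier `m ∈ M(I)`. -/
noncomputable def ClosedIdeal.mulRight {A : Type u} [NonUnitalCStarAlgebra A] {I : ClosedIdeal A}
    (a : I.Elem) (m : I.Mult) : I.Elem := m.snd a

open ClosedIdeal in
/-- A Busby–Smith twisted action `(α, u)` of `S` on `A`. -/
structure BusbySmithAction (S : Type v) [InverseMonoid S] (A : Type u)
    [NonUnitalCStarAlgebra A] where
  /-- The closed ideals `A_s`. -/
  ideal : S → ClosedIdeal A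
  /-- The partial automorphisms `α_s : A_{s*} → A_s`. -/
  aut : ∀ s : S, (ideal s⁻¹).Elem ≃⋆ₐ[ℂ] (ideal s).Elem
  /-- The unitary multipliers `u_{s,t}` of `A_{st}`. -/
  cocycle : ∀ s t : S, unitary (ideal (s * t)).Mult
  ideal_one : ∀ a : A, a ∈ ideal 1
  /-- `α_s α_t` and `Ad u_{s,t} ∘ α_{st}` have the same domain. -/
  mem_domain_comp : ∀ (s t : S) (a : A),
    (∃ h : a ∈ ideal t⁻¹, (aut t ⟨a, h⟩ : A) ∈ ideal s⁻¹) ↔ a ∈ ideal (s * t)⁻¹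
  /-- `α_s α_t` and `Ad u_{s,t} ∘ α_{st}` agree on their domain. -/
  comp_eq : ∀ (s t : S) (a : A) (h : a ∈ ideal t⁻¹) (h' : (aut t ⟨a, h⟩ : A) ∈ ideal s⁻¹)
    (h'' : a ∈ ideal (s * t)⁻¹),
    (aut s ⟨aut t ⟨a, h⟩, h'⟩ : A) =
      mulRight (mulLeft (cocycle s t : (ideal (s * t)).Mult) (aut (s * t) ⟨a, h''⟩))
        (star (cocycle s t : (ideal (s * t)).Mult))
  cocycle_eq_one : ∀ s t : S, (IsIdempotentElem s ∨ IsIdempotentElem t) → cocycle s t = 1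
  /-- `α_r(a u_{s,t}) u_{r,st} = α_r(a) u_{r,s} u_{rs,t}` for `a ∈ A_{r*} A_{st} = A_{r*} ∩ A_{st}`.
  The four memberships say that all products and values in this formula make sense; they follow
  from the other conditions. -/
  cocycle_identity : ∀ (r s t : S) (a : A) (hr : a ∈ ideal r⁻¹) (hst : a ∈ ideal (s * t)),
    ∃ (h₁ : (mulRight ⟨a, hst⟩ (cocycle s t : (ideal (s * t)).Mult) : A) ∈ ideal r⁻¹)
      (h₂ : (aut r ⟨_, h₁⟩ : A) ∈ ideal (r * (s * t)))
      (h₃ : (aut r ⟨a, hr⟩ : A) ∈ ideal (r * s))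
      (h₄ : (mulRight ⟨_, h₃⟩ (cocycle r s : (ideal (r * s)).Mult) : A) ∈ ideal (r * s * t)),
      (mulRight ⟨_, h₂⟩ (cocycle r (s * t) : (ideal (r * (s * t))).Mult) : A) =
        mulRight ⟨_, h₄⟩ (cocycle (r * s) t : (ideal (r * s * t)).Mult)

/-- A Hilbert `A`-`B`-bimodule `X`. `lsmul a x = a · x`, `rsmul x b = x · b`,
`linner x y = _A⟨x, y⟩` (linear in the first variable), `rinner x y = ⟨x, y⟩_B` (linear in the
second variable). `X` is complete in its norm, and this norm is the one given by each of the two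
inner products (the two norms of a Hilbert bimodule always coincide). -/
structure HilbertBimodule (A B X : Type u)
    [NonUnitalCStarAlgebra A] [PartialOrder A] [StarOrderedRing A]
    [NonUnitalCStarAlgebra B] [PartialOrder B] [StarOrderedRing B]
    [NormedAddCommGroup X] [NormedSpace ℂ X] [CompleteSpace X] where
  lsmul : A →ₗ[ℂ] X →ₗ[ℂ] X
  rsmul : X →ₗ[ℂ] B →ₗ[ℂ] X
  linner : X → X → A
  rinner : X → X → B
  lsmul_mul : ∀ a a' x, lsmul (a * a') x = lsmul a (lsmul a' x)
  rsmul_mul : ∀ x b b', rsmul x (b * b') = rsmul (rsmul x b) b'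
  lsmul_rsmul : ∀ a x b, lsmul a (rsmul x b) = rsmul (lsmul a x) b
  rinner_linear : ∀ (c d : ℂ) (x y z : X),
    rinner x (c • y + d • z) = c • rinner x y + d • rinner x z
  rinner_rsmul : ∀ x y b, rinner x (rsmul y b) = rinner x y * b
  star_rinner : ∀ x y, star (rinner x y) = rinner y x
  rinner_self_nonneg : ∀ x, 0 ≤ rinner x x
  norm_sq_eq_rinner : ∀ x, ‖x‖ ^ 2 = ‖rinner x x‖
  linner_linear : ∀ (c d : ℂ) (x y z : X),
    linner (c • x + d • y) z = c • linner x z + d • linner y z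
  linner_lsmul : ∀ a x y, linner (lsmul a x) y = a * linner x y
  star_linner : ∀ x y, star (linner x y) = linner y x
  linner_self_nonneg : ∀ x, 0 ≤ linner x x
  norm_sq_eq_linner : ∀ x, ‖x‖ ^ 2 = ‖linner x x‖
  linner_lsmul_eq : ∀ x y z, lsmul (linner x y) z = rsmul x (rinner y z)

/-- An imprimitivity bimodule: a Hilbert bimodule which is full on both sides. -/
structure ImprimitivityBimodule (A B X : Type u)
    [NonUnitalCStarAlgebra A] [PartialOrder A] [StarOrderedRing A]
    [NonUnitalCStarAlgebra B] [PartialOrder B] [StarOrderedRing B]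
    [NormedAddCommGroup X] [NormedSpace ℂ X] [CompleteSpace X]
    extends HilbertBimodule A B X where
  full_left : closure (Submodule.span ℂ {a | ∃ x y, a = linner x y} : Set A) = Set.univ
  full_right : closure (Submodule.span ℂ {b | ∃ x y, b = rinner x y} : Set B) = Set.univ

namespace HilbertBimodule

variable {A B X : Type u}
  [NonUnitalCStarAlgebra A] [PartialOrder A] [StarOrderedRing A]
  [NonUnitalCStarAlgebra B] [PartialOrder B] [StarOrderedRing B]
  [NormedAddCommGroup X] [NormedSpace ℂ X] [CompleteSpace X]

/-- The closed subspace `I · X`, as the closed linear span of the products `a · x` (by the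
Cohen–Hewitt theorem it consists of the products). -/
def idealMul (M : HilbertBimodule A B X) (I : ClosedIdeal A) : Submodule ℂ X :=
  (Submodule.span ℂ {z | ∃ a ∈ I, ∃ x, z = M.lsmul a x}).topologicalClosure

/-- The closed subspace `X · J`, as the closed linear span of the products `x · b`. -/
def mulIdeal (M : HilbertBimodule A B X) (J : ClosedIdeal B) : Submodule ℂ X :=
  (Submodule.span ℂ {z | ∃ x, ∃ b ∈ J, z = M.rsmul x b}).topologicalClosure

/-- `Y` is a closed subbimodule of `X`, and `I`, `J` are the closed spans of `_A⟨Y, Y⟩` and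
`⟨Y, Y⟩_B`: the triple is the imprimitivity subbimodule `_I Y_J` of `X`. -/
structure IsSubbimodule (M : HilbertBimodule A B X) (I : ClosedIdeal A) (Y : Submodule ℂ X)
    (J : ClosedIdeal B) : Prop where
  isClosed : IsClosed (Y : Set X)
  lsmul_mem : ∀ a, ∀ y ∈ Y, M.lsmul a y ∈ Y
  rsmul_mem : ∀ b, ∀ y ∈ Y, M.rsmul y b ∈ Y
  closure_linner :
    closure (Submodule.span ℂ {a | ∃ x ∈ Y, ∃ y ∈ Y, a = M.linner x y} : Set A) = {a | a ∈ I}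
  closure_rinner :
    closure (Submodule.span ℂ {b | ∃ x ∈ Y, ∃ y ∈ Y, b = M.rinner x y} : Set B) = {b | b ∈ J}

/-- `(α, φ, β)` is a partial automorphism of `X`: an isomorphism of Hilbert bimodules from the
imprimitivity subbimodule `_I Y_J` onto the imprimitivity subbimodule `_I' Y'_J'`. -/
structure IsPartialAut (M : HilbertBimodule A B X) {I I' : ClosedIdeal A} {Y Y' : Submodule ℂ X}
    {J J' : ClosedIdeal B} (α : I.Elem ≃⋆ₐ[ℂ] I'.Elem) (φ : Y → Y')
    (β : J.Elem ≃⋆ₐ[ℂ] J'.Elem) : Prop where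
  source : M.IsSubbimodule I Y J
  target : M.IsSubbimodule I' Y' J'
  map_rsmul : ∀ (x y : Y) (b : J.Elem),
    (y : X) = M.rsmul x b → (φ y : X) = M.rsmul (φ x) (β b)
  map_rinner : ∀ (x y : Y) (b : J.Elem),
    (b : B) = M.rinner x y → (β b : B) = M.rinner (φ x) (φ y)
  map_lsmul : ∀ (x y : Y) (a : I.Elem),
    (y : X) = M.lsmul a x → (φ y : X) = M.lsmul (α a) (φ x)
  map_linner : ∀ (x y : Y) (a : I.Elem),
    (a : A) = M.linner x y → (α a : A) = M.linner (φ x) (φ y)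
  surjective : Function.Surjective φ

/-- `z = m · y` for a multiplier `m ∈ M(I)` and `y ∈ I · X`: the element `m · y` is the unique
`z ∈ I · X` with `a · z = (a m) · y` for all `a ∈ I`. -/
def IsLeftMultiple (M : HilbertBimodule A B X) {I : ClosedIdeal A} (m : I.Mult) (y z : X) : Prop :=
  y ∈ M.idealMul I ∧ z ∈ M.idealMul I ∧
    ∀ a : I.Elem, M.lsmul a z = M.lsmul (ClosedIdeal.mulRight a m) y

/-- `z = y · m` for a multiplier `m ∈ M(J)` and `y ∈ X · J`: the element `y · m` is the unique
`z ∈ X · J` with `z · b = y · (m b)` for all `b ∈ J`. -/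
def IsRightMultiple (M : HilbertBimodule A B X) {J : ClosedIdeal B} (y : X) (m : J.Mult)
    (z : X) : Prop :=
  y ∈ M.mulIdeal J ∧ z ∈ M.mulIdeal J ∧
    ∀ b : J.Elem, M.rsmul z b = M.rsmul y (ClosedIdeal.mulLeft m b)

end HilbertBimodule

/-- A C⋆-algebra (with its order) together with a Busby–Smith twisted action of `S` on it: a
quadruple `(A, S, α, u)` with `S` fixed. -/
structure TwistedSystem (S : Type v) [InverseMonoid S] where
  Alg : Type u
  [cstar : NonUnitalCStarAlgebra Alg]
  [order : PartialOrder Alg]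
  [orderedRing : StarOrderedRing Alg]
  action : BusbySmithAction S Alg

attribute [instance] TwistedSystem.cstar TwistedSystem.order TwistedSystem.orderedRing

/-- A Morita equivalence `(X, φ)` between `(A, S, α, u)` and `(B, S, β, v)`. -/
structure TwistedMoritaEquivalence {S : Type v} [InverseMonoid S] (P Q : TwistedSystem.{u, v} S) where
  X : Type u
  [normed : NormedAddCommGroup X]
  [space : NormedSpace ℂ X]
  [complete : CompleteSpace X]
  bimodule : ImprimitivityBimodule P.Alg Q.Alg X
  /-- `A_s · X = X · B_s`; this subspace is `X_s`. -/
  idealMul_eq : ∀ s : S,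
    bimodule.idealMul (P.action.ideal s) = bimodule.mulIdeal (Q.action.ideal s)
  /-- The maps `φ_s : X_{s*} → X_s`. -/
  map : ∀ s : S, bimodule.idealMul (P.action.ideal s⁻¹) → bimodule.idealMul (P.action.ideal s)
  /-- `(α_s, φ_s, β_s)` is a partial automorphism of `X`. -/
  isPartialAut : ∀ s : S, bimodule.IsPartialAut (P.action.aut s) (map s) (Q.action.aut s)
  /-- `φ_s φ_t` and `u_{s,t} · φ_{st}(·) · v_{s,t}^*` have the same domain. -/
  mem_domain_comp : ∀ (s t : S) (x : X),
    (∃ h : x ∈ bimodule.idealMul (P.action.ideal t⁻¹),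
      (map t ⟨x, h⟩ : X) ∈ bimodule.idealMul (P.action.ideal s⁻¹)) ↔
      x ∈ bimodule.idealMul (P.action.ideal (s * t)⁻¹)
  /-- `φ_s φ_t = u_{s,t} · φ_{st}(·) · v_{s,t}^*` on their domain; `z` is `u_{s,t} · φ_{st}(x)`. -/
  comp_eq : ∀ (s t : S) (x : X) (h : x ∈ bimodule.idealMul (P.action.ideal t⁻¹))
    (h' : (map t ⟨x, h⟩ : X) ∈ bimodule.idealMul (P.action.ideal s⁻¹))
    (h'' : x ∈ bimodule.idealMul (P.action.ideal (s * t)⁻¹)),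
    ∃ z : X,
      bimodule.IsLeftMultiple (P.action.cocycle s t : (P.action.ideal (s * t)).Mult)
        (map (s * t) ⟨x, h''⟩) z ∧
      bimodule.IsRightMultiple z (star (Q.action.cocycle s t : (Q.action.ideal (s * t)).Mult))
        (map s ⟨map t ⟨x, h⟩, h'⟩)

attribute [instance] TwistedMoritaEquivalence.normed TwistedMoritaEquivalence.space TwistedMoritaEquivalence.complete

/-- Morita equivalence of twisted actions. -/
def TwistedMoritaEquivalent {S : Type v} [InverseMonoid S] (P Q : TwistedSystem.{u, v} S) : Prop :=
  Nonempty (TwistedMoritaEquivalence P Q)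

/-- `(X', φ')` is the reverse of `(X, φ)`: via a conjugate-linear bijection `x ↦ x~`, `X'` is the
reverse bimodule of `X`, and `φ'_s(x~) = φ_s(x)~`. -/
def TwistedMoritaEquivalence.IsReverse {S : Type v} [InverseMonoid S] {P Q : TwistedSystem.{u, v} S}
    (E' : TwistedMoritaEquivalence Q P) (E : TwistedMoritaEquivalence P Q) : Prop :=
  ∃ j : E.X ≃ₛₗ[starRingEnd ℂ] E'.X,
    (∀ (b : Q.Alg) (x : E.X), E'.bimodule.lsmul b (j x) = j (E.bimodule.rsmul x (star b))) ∧
    (∀ (x : E.X) (a : P.Alg), E'.bimodule.rsmul (j x) a = j (E.bimodule.lsmul (star a) x)) ∧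
    (∀ x y : E.X, E'.bimodule.linner (j x) (j y) = E.bimodule.rinner x y) ∧
    (∀ x y : E.X, E'.bimodule.rinner (j x) (j y) = E.bimodule.linner x y) ∧
    ∀ (s : S) (x : E.bimodule.idealMul (P.action.ideal s⁻¹)),
      ∃ h : j x ∈ E'.bimodule.idealMul (Q.action.ideal s⁻¹),
        (E'.map s ⟨j x, h⟩ : E'.X) = j (E.map s x)

/-- `(Z, θ)` is the balanced tensor product of `(X, φ)` and `(Y, ψ)`: via a bilinear map
`(x, y) ↦ x ⊗ y` whose values span a dense subspace, `Z` is the balanced tensor product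
`X ⊗_B Y`, and `θ_s(x ⊗ y) = φ_s(x) ⊗ ψ_s(y)` for `x ∈ X_{s*}`, `y ∈ Y_{s*}`. -/
def TwistedMoritaEquivalence.IsTensorProduct {S : Type v} [InverseMonoid S]
    {P Q R : TwistedSystem.{u, v} S} (G : TwistedMoritaEquivalence P R)
    (E : TwistedMoritaEquivalence P Q) (F : TwistedMoritaEquivalence Q R) : Prop :=
  ∃ τ : E.X →ₗ[ℂ] F.X →ₗ[ℂ] G.X,
    closure (Submodule.span ℂ {z | ∃ x y, z = τ x y} : Set G.X) = Set.univ ∧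
    (∀ (x : E.X) (b : Q.Alg) (y : F.X),
      τ (E.bimodule.rsmul x b) y = τ x (F.bimodule.lsmul b y)) ∧
    (∀ (a : P.Alg) (x : E.X) (y : F.X),
      G.bimodule.lsmul a (τ x y) = τ (E.bimodule.lsmul a x) y) ∧
    (∀ (x : E.X) (y : F.X) (c : R.Alg),
      G.bimodule.rsmul (τ x y) c = τ x (F.bimodule.rsmul y c)) ∧
    (∀ (x₁ x₂ : E.X) (y₁ y₂ : F.X), G.bimodule.rinner (τ x₁ y₁) (τ x₂ y₂) =
      F.bimodule.rinner y₁ (F.bimodule.lsmul (E.bimodule.rinner x₁ x₂) y₂)) ∧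
    ∀ (s : S) (x : E.bimodule.idealMul (P.action.ideal s⁻¹))
      (y : F.bimodule.idealMul (Q.action.ideal s⁻¹)),
      ∃ h : τ x y ∈ G.bimodule.idealMul (P.action.ideal s⁻¹),
        (G.map s ⟨τ x y, h⟩ : G.X) = τ (E.map s x) (F.map s y)

/-!
The reverse bimodule and the balanced tensor product give symmetry and transitivity; reflexivity is
the bimodule `A` with the maps `α_s`. Two observations shorten the verification of the axioms.

* An element `x` lies in `I · X` if and only if `_A⟨x, x⟩ ∈ I`
  (`HilbertBimodule.mem_idealMul_iff`, by an approximate unit of `I`). As `φ_t` intertwines inner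
  products, the equality of the domains of `φ_s φ_t` and `φ_{st}` follows from the one for `α`.
* The relation `w = u · y · v*` for unitary multipliers `u`, `v` may be tested by acting with both
  ideals: `a · w · b = (a u) · y · (v* b)`
  (`HilbertBimodule.exists_isLeftMultiple_isRightMultiple_iff`). This is symmetric in left and
  right and involves bounded maps only.

`TwistedMoritaEquivalence.ofPartialAut` combines the two. Many statements about one side of a
bimodule are deduced from the other side through the reverse bimodule.

The tensor product `X ⊗_B Y` is realized as a space of operators instead of a completion: `x ⊗ y`
acts as `w ↦ x · _B⟨y, w⟩` from the reverse of `Y` to `X`, with adjoint `x' ↦ ⟨x', x⟩_B · y`, and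
`X ⊗_B Y` is the closed span of these pairs. For two elements `z₁`, `z₂` the operator `z₁ z₂*` is
the action of a unique element of `A`, because the actions of `A` on `X` and of `C` on `Y` are
isometric (`ImprimitivityBimodule.norm_le_of_forall_norm_lsmul_le`), so that their ranges are
closed; this element is `_A⟨z₁, z₂⟩`, and `⟨z₁, z₂⟩_C` is obtained in the same way from the
operator `z₂* z₁` on `Y`. These inner products are positive because they act positively on `X` and
`Y` (`ImprimitivityBimodule.nonneg_of_forall_linner_lsmul`).

The maps `φ_s ⊗ ψ_s` are defined through their graphs, the closed spans of the pairs
`(x ⊗ y, φ_s(x) ⊗ ψ_s(y))`. They respect the inner products up to the isomorphisms of the ideals,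
hence are isometric, so their graphs are graphs of maps with closed domain and range
(`Submodule.exists_mem_topologicalClosure_of_isometric`); multiplication by a unitary multiplier is
constructed by the same principle. Domain and range are the right ones by
`tensor_idealMul_eq_closure_span`. Finally `φ_s φ_t = u · φ_{st} · v*` and
`ψ_s ψ_t = v · ψ_{st} · w*` combine to `u · (φ_{st} ⊗ ψ_{st}) · w*`, because
`(x · v*) ⊗ (v · y) = x ⊗ y`.
-/

open Filter Topology

/-! ### C⋆-algebras and their ideals -/

section CStar

variable {A : Type u} [NonUnitalCStarAlgebra A]

/-- An approximate unit of a closed ideal, as a filter on the ambient algebra. -/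
theorem ClosedIdeal.exists_approximateUnit (I : ClosedIdeal A) :
    ∃ l : Filter A, l.NeBot ∧ (∀ᶠ e in l, e ∈ I) ∧ (∀ᶠ e in l, ‖e‖ ≤ 1) ∧
      (∀ a ∈ I, Tendsto (fun e => e * a) l (𝓝 a)) ∧
      (∀ a ∈ I, Tendsto (fun e => a * e) l (𝓝 a)) := by
  let _ : PartialOrder I.Elem := CStarAlgebra.spectralOrder I.Elem
  let _ : StarOrderedRing I.Elem := CStarAlgebra.spectralOrderedRing I.Elem
  have h := CStarAlgebra.increasingApproximateUnit I.Elem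
  refine ⟨(CStarAlgebra.approximateUnit I.Elem).map Subtype.val, inferInstance, ?_, ?_, ?_, ?_⟩
  · exact Filter.eventually_map.2 (Filter.Eventually.of_forall fun e => e.2)
  · exact Filter.eventually_map.2 (by simpa using h.eventually_norm)
  · intro a ha
    rw [Filter.tendsto_map'_iff]
    exact (continuous_subtype_val.tendsto _).comp (h.tendsto_mul_right ⟨a, ha⟩)
  · intro a ha
    rw [Filter.tendsto_map'_iff]
    exact (continuous_subtype_val.tendsto _).comp (h.tendsto_mul_left ⟨a, ha⟩)

theorem ClosedIdeal.star_mem {I : ClosedIdeal A} {a : A} (ha : a ∈ I) : star a ∈ I :=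
  I.alg.star_mem' ha

/-- The ideal as a subspace. -/
def ClosedIdeal.toSubmodule (I : ClosedIdeal A) : Submodule ℂ A := I.alg.toSubmodule

theorem ClosedIdeal.isClosed_toSubmodule (I : ClosedIdeal A) :
    IsClosed (I.toSubmodule : Set A) := I.isClosed

theorem ClosedIdeal.eq_of_forall_mul_left {I : ClosedIdeal A} {a b : A} (ha : a ∈ I) (hb : b ∈ I)
    (h : ∀ c ∈ I, c * a = c * b) : a = b := by
  obtain ⟨l, hl, hmem, -, hleft, -⟩ := I.exists_approximateUnit
  refine tendsto_nhds_unique (hleft a ha) ((hleft b hb).congr' ?_)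
  filter_upwards [hmem] with e he using (h e he).symm

/-- The whole algebra as an ideal. -/
def ClosedIdeal.whole (A : Type u) [NonUnitalCStarAlgebra A] : ClosedIdeal A where
  alg := ⊤
  isClosed := isClosed_univ
  mul_mem_left _ _ _ := trivial
  mul_mem_right _ _ _ := trivial

end CStar

/-! ### Multipliers of an ideal -/

namespace ClosedIdeal

variable {A : Type u} [NonUnitalCStarAlgebra A] {I : ClosedIdeal A}

theorem mulRight_mul (a b : I.Elem) (m : I.Mult) : mulRight a m * b = a * mulLeft m b :=
  m.central a b

theorem elem_eq_of_forall_mul {a b : I.Elem} (h : ∀ c : I.Elem, c * a = c * b) : a = b :=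
  Subtype.ext (eq_of_forall_mul_left a.2 b.2 fun c hc => congrArg Subtype.val (h ⟨c, hc⟩))

theorem mulLeft_mul (a b : I.Elem) (m : I.Mult) : mulLeft m (a * b) = mulLeft m a * b :=
  elem_eq_of_forall_mul fun c => by
    rw [← mulRight_mul, ← mul_assoc, mulRight_mul, mul_assoc]

theorem star_mulLeft (a : I.Elem) (m : I.Mult) :
    star (mulLeft m a) = mulRight (star a) (star m) := by
  simp [mulLeft, mulRight]

theorem star_mulRight (a : I.Elem) (m : I.Mult) :
    star (mulRight a m) = mulLeft (star m) (star a) := by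
  simp [mulLeft, mulRight]

theorem mulLeft_mulLeft (m n : I.Mult) (a : I.Elem) :
    mulLeft m (mulLeft n a) = mulLeft (m * n) a := rfl

theorem mulLeft_one (a : I.Elem) : mulLeft (1 : I.Mult) a = a := rfl

end ClosedIdeal

/-! ### The conjugate space -/

/-- The conjugate of a complex normed space: the same group and norm, with `c` acting as the
conjugate of `c`. -/
def ConjSpace (X : Type u) : Type u := X

namespace ConjSpace

variable (X : Type u) [NormedAddCommGroup X] [NormedSpace ℂ X]

noncomputable instance : NormedAddCommGroup (ConjSpace X) :=
  inferInstanceAs (NormedAddCommGroup X)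

noncomputable instance : Module ℂ (ConjSpace X) :=
  Module.compHom X (starRingEnd ℂ)

noncomputable instance : NormedSpace ℂ (ConjSpace X) where
  norm_smul_le c x :=
    (norm_smul_le (starRingEnd ℂ c) (show X from x)).trans_eq (by rw [RCLike.norm_conj]; rfl)

instance [CompleteSpace X] : CompleteSpace (ConjSpace X) := inferInstanceAs (CompleteSpace X)

/-- The conjugate-linear identification `x ↦ x~` of `X` with its conjugate. -/
noncomputable def conj : X ≃ₛₗᵢ[starRingEnd ℂ] ConjSpace X where
  toFun x := x
  invFun x := x
  left_inv _ := rfl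
  right_inv _ := rfl
  map_add' _ _ := rfl
  map_smul' c x := by
    change c • x = starRingEnd ℂ (starRingEnd ℂ c) • x
    simp
  norm_map' _ := rfl

variable {X}

theorem conj_smul (c : ℂ) (x : X) : conj X (c • x) = starRingEnd ℂ c • conj X x :=
  (conj X).map_smulₛₗ c x

theorem conj_symm_smul (c : ℂ) (x : ConjSpace X) :
    (conj X).symm (c • x) = starRingEnd ℂ c • (conj X).symm x :=
  rfl

end ConjSpace

/-! ### Inner products and the reverse bimodule -/

namespace HilbertBimodule

variable {A B X : Type u}
  [NonUnitalCStarAlgebra A] [PartialOrder A] [StarOrderedRing A]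
  [NonUnitalCStarAlgebra B] [PartialOrder B] [StarOrderedRing B]
  [NormedAddCommGroup X] [NormedSpace ℂ X] [CompleteSpace X]
  (M : HilbertBimodule A B X)

open ConjSpace in
/-- The reverse bimodule. -/
noncomputable def reverse : HilbertBimodule B A (ConjSpace X) where
  lsmul := LinearMap.mk₂ ℂ (fun b x => conj X (M.rsmul ((conj X).symm x) (star b)))
    (by simp) (by simp [conj_smul]) (by simp) (by simp [conj_smul, conj_symm_smul])
  rsmul := LinearMap.mk₂ ℂ (fun x a => conj X (M.lsmul (star a) ((conj X).symm x)))
    (by simp) (by simp [conj_smul, conj_symm_smul]) (by simp) (by simp [conj_smul])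
  linner x y := M.rinner ((conj X).symm x) ((conj X).symm y)
  rinner x y := M.linner ((conj X).symm x) ((conj X).symm y)
  lsmul_mul := by simp [M.rsmul_mul]
  rsmul_mul := by simp [M.lsmul_mul]
  lsmul_rsmul := by simp [M.lsmul_rsmul]
  rinner_linear c d x y z := by
    apply star_injective
    simp [M.star_linner, M.linner_linear, conj_symm_smul]
  rinner_rsmul x y b := by
    apply star_injective
    simp [M.star_linner, M.linner_lsmul]
  star_rinner _ _ := M.star_linner _ _
  rinner_self_nonneg _ := M.linner_self_nonneg _
  norm_sq_eq_rinner x := by rw [← M.norm_sq_eq_linner, LinearIsometryEquiv.norm_map]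
  linner_linear c d x y z := by
    apply star_injective
    simp [M.star_rinner, M.rinner_linear, conj_symm_smul]
  linner_lsmul a x y := by
    apply star_injective
    simp [M.star_rinner, M.rinner_rsmul]
  star_linner _ _ := M.star_rinner _ _
  linner_self_nonneg _ := M.rinner_self_nonneg _
  norm_sq_eq_linner x := by rw [← M.norm_sq_eq_rinner, LinearIsometryEquiv.norm_map]
  linner_lsmul_eq x y z := by
    simp [M.star_rinner, M.star_linner, M.linner_lsmul_eq]

open ConjSpace

theorem reverse_lsmul (b : B) (x : X) :
    M.reverse.lsmul b (conj X x) = conj X (M.rsmul x (star b)) := rfl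

theorem reverse_rsmul (a : A) (x : X) :
    M.reverse.rsmul (conj X x) a = conj X (M.lsmul (star a) x) := rfl

theorem reverse_rinner (x y : X) :
    M.reverse.rinner (conj X x) (conj X y) = M.linner x y := rfl

theorem rinner_mul_eq_zero {d : B} (h : ∀ z, M.rsmul z d = 0) (x y : X) :
    M.rinner x y * d = 0 := by
  rw [← M.rinner_rsmul, h]
  simpa using M.rinner_linear 0 0 x 0 0

theorem linner_lsmul_right (a : A) (x y : X) :
    M.linner x (M.lsmul a y) = M.linner x y * star a := by
  rw [← M.star_linner, M.linner_lsmul, star_mul, M.star_linner]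

theorem rinner_rsmul_left (b : B) (x y : X) :
    M.rinner (M.rsmul x b) y = star b * M.rinner x y := by
  rw [← M.star_rinner, M.rinner_rsmul, star_mul, M.star_rinner]

/-- The left action is by adjointable operators for the right inner product. -/
theorem rinner_lsmul (a : A) (x y : X) :
    M.rinner x (M.lsmul a y) = M.rinner (M.lsmul (star a) x) y := by
  set d := M.rinner x (M.lsmul a y) - M.rinner (M.lsmul (star a) x) y with hd
  -- `d` annihilates `X`, hence all inner products, hence `star d * d`
  have h : ∀ z, M.rsmul z d = 0 := fun z => by
    rw [hd, map_sub, ← M.linner_lsmul_eq, ← M.linner_lsmul_eq, M.linner_lsmul_right, star_star,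
      M.lsmul_mul, sub_self]
  have : star d * d = 0 := by
    conv_lhs => enter [1]; rw [hd]
    rw [star_sub, M.star_rinner, M.star_rinner, sub_mul, M.rinner_mul_eq_zero h,
      M.rinner_mul_eq_zero h, sub_zero]
  exact sub_eq_zero.1 (CStarRing.star_mul_self_eq_zero_iff d |>.1 this)

theorem rinner_lsmul_left (a : A) (x y : X) :
    M.rinner (M.lsmul a x) y = M.rinner x (M.lsmul (star a) y) := by
  rw [M.rinner_lsmul, star_star]

theorem linner_rsmul (b : B) (x y : X) :
    M.linner (M.rsmul x b) y = M.linner x (M.rsmul y (star b)) := by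
  have := M.reverse.rinner_lsmul b (conj X x) (conj X y)
  simpa [M.reverse_lsmul, M.reverse_rinner] using this.symm

theorem norm_rsmul_le (x : X) (b : B) : ‖M.rsmul x b‖ ≤ ‖x‖ * ‖b‖ := by
  refine le_of_sq_le_sq ?_ (by positivity)
  rw [M.norm_sq_eq_rinner, M.rinner_rsmul, M.rinner_rsmul_left, mul_pow, M.norm_sq_eq_rinner]
  calc _ ≤ ‖star b‖ * ‖M.rinner x x‖ * ‖b‖ :=
        (norm_mul_le _ _).trans (by gcongr; exact norm_mul_le _ _)
    _ = _ := by rw [norm_star]; ring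

theorem norm_lsmul_le (a : A) (x : X) : ‖M.lsmul a x‖ ≤ ‖a‖ * ‖x‖ := by
  have := M.reverse.norm_rsmul_le (conj X x) (star a)
  rw [M.reverse_rsmul, star_star, LinearIsometryEquiv.norm_map, LinearIsometryEquiv.norm_map,
    norm_star, mul_comm] at this
  exact this

/-- The Cauchy–Schwarz inequality. With `_A⟨x, x⟩ = h* h`, the square of the norm of `⟨x, y⟩_B` is
the norm of `⟨y, _A⟨x, x⟩ y⟩_B = ⟨h y, h y⟩_B`. -/
theorem norm_rinner_le (x y : X) : ‖M.rinner x y‖ ≤ ‖x‖ * ‖y‖ := by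
  obtain ⟨h, hh⟩ := CStarAlgebra.nonneg_iff_eq_star_mul_self.1 (M.linner_self_nonneg x)
  refine le_of_sq_le_sq ?_ (by positivity)
  have h1 : star (M.rinner x y) * M.rinner x y =
      M.rinner (M.lsmul h y) (M.lsmul h y) := by
    rw [M.star_rinner, ← M.rinner_rsmul, ← M.linner_lsmul_eq, hh, M.lsmul_mul, M.rinner_lsmul,
      star_star]
  rw [sq, ← CStarRing.norm_star_mul_self, h1, ← M.norm_sq_eq_rinner, mul_pow,
    M.norm_sq_eq_linner x, hh, CStarRing.norm_star_mul_self, ← sq, ← mul_pow]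
  gcongr
  exact M.norm_lsmul_le h y

theorem norm_linner_le (x y : X) : ‖M.linner x y‖ ≤ ‖x‖ * ‖y‖ := by
  have := M.reverse.norm_rinner_le (conj X x) (conj X y)
  rwa [M.reverse_rinner, LinearIsometryEquiv.norm_map, LinearIsometryEquiv.norm_map] at this

/-- The left action as a bounded bilinear map. -/
noncomputable def lsmulL : A →L[ℂ] X →L[ℂ] X :=
  M.lsmul.mkContinuous₂ 1 fun a x => by simpa using M.norm_lsmul_le a x

/-- The right action as a bounded bilinear map. -/
noncomputable def rsmulL : X →L[ℂ] B →L[ℂ] X :=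
  M.rsmul.mkContinuous₂ 1 fun x b => by simpa using M.norm_rsmul_le x b

/-- The right inner product as a bounded sesquilinear map. -/
noncomputable def rinnerL : X →L⋆[ℂ] X →L[ℂ] B :=
  (LinearMap.mk₂'ₛₗ (starRingEnd ℂ) (RingHom.id ℂ) M.rinner
    (fun x y z => star_injective (by
      simpa [M.star_rinner] using M.rinner_linear 1 1 z x y))
    (fun c x z => star_injective (by
      simpa [M.star_rinner] using M.rinner_linear c 0 z x 0))
    (fun z x y => by simpa using M.rinner_linear 1 1 z x y)
    (fun c z x => by simpa using M.rinner_linear c 0 z x 0)).mkContinuous₂ 1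
      fun x y => by simpa using M.norm_rinner_le x y

/-- The left inner product as a bounded sesquilinear map. -/
noncomputable def linnerL : X →L[ℂ] X →L⋆[ℂ] A :=
  (LinearMap.mk₂'ₛₗ (RingHom.id ℂ) (starRingEnd ℂ) M.linner
    (fun x y z => by simpa using M.linner_linear 1 1 x y z)
    (fun c x z => by simpa using M.linner_linear c 0 x 0 z)
    (fun z x y => star_injective (by
      simpa [M.star_linner] using M.linner_linear 1 1 x y z))
    (fun c z x => star_injective (by
      simpa [M.star_linner] using M.linner_linear c 0 x 0 z))).mkContinuous₂ 1
      fun x y => by simpa using M.norm_linner_le x y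

theorem lsmulL_apply (a : A) (x : X) : M.lsmulL a x = M.lsmul a x := rfl
theorem rsmulL_apply (x : X) (b : B) : M.rsmulL x b = M.rsmul x b := rfl
theorem rinnerL_apply (x y : X) : M.rinnerL x y = M.rinner x y := rfl
theorem linnerL_apply (x y : X) : M.linnerL x y = M.linner x y := rfl

end HilbertBimodule

/-! ### Subspaces cut out by ideals -/

namespace HilbertBimodule

variable {A B X : Type u}
  [NonUnitalCStarAlgebra A] [PartialOrder A] [StarOrderedRing A]
  [NonUnitalCStarAlgebra B] [PartialOrder B] [StarOrderedRing B]
  [NormedAddCommGroup X] [NormedSpace ℂ X] [CompleteSpace X]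
  (M : HilbertBimodule A B X) {I : ClosedIdeal A} {J : ClosedIdeal B}

theorem lsmul_mem_idealMul {a : A} (ha : a ∈ I) (x : X) : M.lsmul a x ∈ M.idealMul I :=
  Submodule.le_topologicalClosure _ (Submodule.subset_span ⟨a, ha, x, rfl⟩)

theorem rsmul_mem_mulIdeal (x : X) {b : B} (hb : b ∈ J) : M.rsmul x b ∈ M.mulIdeal J :=
  Submodule.le_topologicalClosure _ (Submodule.subset_span ⟨x, b, hb, rfl⟩)

theorem isClosed_idealMul : IsClosed (M.idealMul I : Set X) :=
  Submodule.isClosed_topologicalClosure _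

theorem isClosed_mulIdeal : IsClosed (M.mulIdeal J : Set X) :=
  Submodule.isClosed_topologicalClosure _

theorem idealMul_le {N : Submodule ℂ X} (hN : IsClosed (N : Set X))
    (h : ∀ a ∈ I, ∀ x, M.lsmul a x ∈ N) : M.idealMul I ≤ N := by
  refine Submodule.topologicalClosure_minimal _ (Submodule.span_le.2 ?_) hN
  rintro _ ⟨a, ha, x, rfl⟩
  exact h a ha x

theorem mulIdeal_le {N : Submodule ℂ X} (hN : IsClosed (N : Set X))
    (h : ∀ x, ∀ b ∈ J, M.rsmul x b ∈ N) : M.mulIdeal J ≤ N := by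
  refine Submodule.topologicalClosure_minimal _ (Submodule.span_le.2 ?_) hN
  rintro _ ⟨x, b, hb, rfl⟩
  exact h x b hb

open ConjSpace

theorem conj_mem_reverse_idealMul {x : X} :
    conj X x ∈ M.reverse.idealMul J ↔ x ∈ M.mulIdeal J := by
  constructor
  · intro hx
    refine M.reverse.idealMul_le (N := (M.mulIdeal J).comap (conj X).symm.toLinearEquiv.toLinearMap)
      (M.isClosed_mulIdeal.preimage (conj X).symm.continuous) ?_ hx
    intro b hb y
    exact M.rsmul_mem_mulIdeal _ (ClosedIdeal.star_mem hb)
  · intro hx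
    refine M.mulIdeal_le (N := (M.reverse.idealMul J).comap (conj X).toLinearEquiv.toLinearMap)
      (M.reverse.isClosed_idealMul.preimage (conj X).continuous) ?_ hx
    intro y b hb
    have := M.reverse.lsmul_mem_idealMul (ClosedIdeal.star_mem hb) (conj X y)
    rwa [M.reverse_lsmul, star_star] at this

theorem linner_mem_of_mem_left {x : X} (hx : x ∈ M.idealMul I) (y : X) : M.linner x y ∈ I := by
  refine M.idealMul_le (N := I.toSubmodule.comap ((M.linnerL.flip y : X →L[ℂ] A) : X →ₗ[ℂ] A))
    (I.isClosed_toSubmodule.preimage (M.linnerL.flip y).continuous) ?_ hx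
  intro a ha z
  change M.linner (M.lsmul a z) y ∈ I
  rw [M.linner_lsmul]
  exact I.mul_mem_right _ ha

theorem linner_mem_of_mem_right (x : X) {y : X} (hy : y ∈ M.idealMul I) : M.linner x y ∈ I := by
  rw [← M.star_linner]
  exact ClosedIdeal.star_mem (M.linner_mem_of_mem_left hy x)

theorem rinner_mem_of_mem_left {x : X} (hx : x ∈ M.mulIdeal J) (y : X) : M.rinner x y ∈ J :=
  M.reverse.linner_mem_of_mem_left (M.conj_mem_reverse_idealMul.2 hx) (conj X y)

theorem rinner_mem_of_mem_right (x : X) {y : X} (hy : y ∈ M.mulIdeal J) : M.rinner x y ∈ J :=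
  M.reverse.linner_mem_of_mem_right (conj X x) (M.conj_mem_reverse_idealMul.2 hy)

/-- A left approximate unit of an ideal containing `_A⟨x, x⟩` acts on `x` as one. -/
theorem tendsto_lsmul {x : X} (hx : M.linner x x ∈ I) {l : Filter A}
    (h1 : ∀ᶠ e in l, ‖e‖ ≤ 1) (h2 : ∀ a ∈ I, Tendsto (fun e => e * a) l (𝓝 a)) :
    Tendsto (fun e => M.lsmul e x) l (𝓝 x) := by
  have hg := tendsto_iff_norm_sub_tendsto_zero.1 (h2 _ hx)
  rw [tendsto_iff_norm_sub_tendsto_zero]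
  have key : ∀ᶠ e in l, ‖M.lsmul e x - x‖ ^ 2 ≤
      ‖e * M.linner x x - M.linner x x‖ * 2 := by
    filter_upwards [h1] with e he
    have : M.linner (M.lsmul e x - x) (M.lsmul e x - x) =
        (e * M.linner x x - M.linner x x) * star e - (e * M.linner x x - M.linner x x) := by
      simp only [← M.linnerL_apply, map_sub, sub_apply]
      simp only [M.linnerL_apply, M.linner_lsmul, M.linner_lsmul_right, sub_mul, mul_assoc]
    rw [M.norm_sq_eq_linner, this]
    calc _ ≤ ‖e * M.linner x x - M.linner x x‖ * ‖star e‖ + ‖e * M.linner x x - M.linner x x‖ :=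
          (norm_sub_le _ _).trans (by gcongr; exact norm_mul_le _ _)
      _ ≤ ‖e * M.linner x x - M.linner x x‖ * 1 + ‖e * M.linner x x - M.linner x x‖ := by
          rw [norm_star]; gcongr
      _ = _ := by ring
  have h3 : Tendsto (fun e => ‖M.lsmul e x - x‖ ^ 2) l (𝓝 0) :=
    squeeze_zero' (Eventually.of_forall fun _ => by positivity) key
      (by simpa using hg.mul_const 2)
  simpa [Function.comp_def] using (Real.continuous_sqrt.tendsto _).comp h3

/-- Membership in `I · X` is a condition on the inner square. It makes the equality of domains in
a Morita equivalence a consequence of the one for the actions. -/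
theorem mem_idealMul_iff {x : X} : x ∈ M.idealMul I ↔ M.linner x x ∈ I := by
  refine ⟨fun h => M.linner_mem_of_mem_left h x, fun h => ?_⟩
  obtain ⟨l, hl, hmem, h1, h2, -⟩ := I.exists_approximateUnit
  refine M.isClosed_idealMul.mem_of_tendsto (M.tendsto_lsmul h h1 h2) ?_
  filter_upwards [hmem] with e he using M.lsmul_mem_idealMul he x

theorem mem_mulIdeal_iff {x : X} : x ∈ M.mulIdeal J ↔ M.rinner x x ∈ J :=
  M.conj_mem_reverse_idealMul.symm.trans M.reverse.mem_idealMul_iff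

theorem lsmul_mem {y : X} (a : A) (hy : y ∈ M.idealMul I) : M.lsmul a y ∈ M.idealMul I := by
  rw [mem_idealMul_iff, M.linner_lsmul]
  exact I.mul_mem_left _ (M.linner_mem_of_mem_right _ (M.idealMul_le
    (N := (M.idealMul I).comap (M.lsmul a)) (M.isClosed_idealMul.preimage (M.lsmulL a).continuous)
    (fun a' ha' x => by
      rw [Submodule.mem_comap, ← M.lsmul_mul]
      exact M.lsmul_mem_idealMul (I.mul_mem_left _ ha') x) hy))

theorem rsmul_mem_idealMul {y : X} (b : B) (hy : y ∈ M.idealMul I) :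
    M.rsmul y b ∈ M.idealMul I := by
  rw [mem_idealMul_iff, M.linner_rsmul]
  exact M.linner_mem_of_mem_left hy _

theorem lsmul_mem_mulIdeal {y : X} (a : A) (hy : y ∈ M.mulIdeal J) :
    M.lsmul a y ∈ M.mulIdeal J := by
  rw [mem_mulIdeal_iff, M.rinner_lsmul]
  exact M.rinner_mem_of_mem_right _ hy

theorem conj_mem_reverse_mulIdeal {x : X} :
    conj X x ∈ M.reverse.mulIdeal I ↔ x ∈ M.idealMul I :=
  M.reverse.mem_mulIdeal_iff.trans M.mem_idealMul_iff.symm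

/-- Elements of `I · X` are separated by the action of `I`. -/
theorem eq_of_forall_lsmul {x y : X} (hx : x ∈ M.idealMul I) (hy : y ∈ M.idealMul I)
    (h : ∀ a ∈ I, M.lsmul a x = M.lsmul a y) : x = y := by
  obtain ⟨l, hl, hmem, h1, h2, -⟩ := I.exists_approximateUnit
  refine tendsto_nhds_unique (M.tendsto_lsmul (M.mem_idealMul_iff.1 hx) h1 h2)
    ((M.tendsto_lsmul (M.mem_idealMul_iff.1 hy) h1 h2).congr' ?_)
  filter_upwards [hmem] with e he using (h e he).symm

theorem eq_of_forall_rsmul {x y : X} (hx : x ∈ M.mulIdeal J) (hy : y ∈ M.mulIdeal J)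
    (h : ∀ b ∈ J, M.rsmul x b = M.rsmul y b) : x = y :=
  (conj X).injective (M.reverse.eq_of_forall_lsmul (M.conj_mem_reverse_idealMul.2 hx)
    (M.conj_mem_reverse_idealMul.2 hy) fun _ hb =>
      congrArg (conj X) (h _ (ClosedIdeal.star_mem hb)))

theorem idealMul_whole (x : X) : x ∈ M.idealMul (ClosedIdeal.whole A) :=
  M.mem_idealMul_iff.2 trivial

theorem mulIdeal_whole (x : X) : x ∈ M.mulIdeal (ClosedIdeal.whole B) :=
  M.mem_mulIdeal_iff.2 trivial

end HilbertBimodule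

/-! ### Faithfulness and isometry of the actions -/

namespace ImprimitivityBimodule

variable {A B X : Type u}
  [NonUnitalCStarAlgebra A] [PartialOrder A] [StarOrderedRing A]
  [NonUnitalCStarAlgebra B] [PartialOrder B] [StarOrderedRing B]
  [NormedAddCommGroup X] [NormedSpace ℂ X] [CompleteSpace X]
  (M : ImprimitivityBimodule A B X) {I : ClosedIdeal A} {J : ClosedIdeal B}

/-- The reverse of an imprimitivity bimodule. -/
noncomputable def reverse : ImprimitivityBimodule B A (ConjSpace X) where
  toHilbertBimodule := M.toHilbertBimodule.reverse
  full_left := M.full_right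
  full_right := M.full_left

open ConjSpace

theorem linner_induction {N : Submodule ℂ A} (hN : IsClosed (N : Set A))
    (h : ∀ x y, M.linner x y ∈ N) (a : A) : a ∈ N := by
  have : closure (Submodule.span ℂ {a | ∃ x y, a = M.linner x y} : Set A) ⊆ N := by
    refine closure_minimal (Submodule.span_le.2 ?_) hN
    rintro _ ⟨x, y, rfl⟩
    exact h x y
  rw [M.full_left] at this
  exact this trivial

theorem rinner_induction {N : Submodule ℂ B} (hN : IsClosed (N : Set B))
    (h : ∀ x y, M.rinner x y ∈ N) (b : B) : b ∈ N :=
  M.reverse.linner_induction hN (fun x y => h ((conj X).symm x) ((conj X).symm y)) b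

theorem eq_zero_of_forall_lsmul {a : A} (h : ∀ x, M.lsmul a x = 0) : a = 0 := by
  have h0 : ∀ c, a * c = 0 := by
    refine M.linner_induction (N := LinearMap.ker (LinearMap.mulLeft ℂ a))
      (isClosed_singleton.preimage (continuous_const_mul a)) fun x y => ?_
    rw [LinearMap.mem_ker, LinearMap.mulLeft_apply, ← M.linner_lsmul, h, ← M.linnerL_apply]
    simp
  exact CStarRing.mul_star_self_eq_zero_iff a |>.1 (h0 _)

theorem eq_zero_of_forall_rsmul {b : B} (h : ∀ x, M.rsmul x b = 0) : b = 0 := by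
  have := M.reverse.eq_zero_of_forall_lsmul (a := star b) fun x => by
    change conj X (M.rsmul ((conj X).symm x) (star (star b))) = 0
    rw [star_star, h, map_zero]
  simpa using this

theorem eq_of_forall_lsmul {a a' : A} (h : ∀ x, M.lsmul a x = M.lsmul a' x) : a = a' :=
  sub_eq_zero.1 (M.eq_zero_of_forall_lsmul fun x => by simp [h])

theorem eq_of_forall_rsmul {b b' : B} (h : ∀ x, M.rsmul x b = M.rsmul x b') : b = b' :=
  sub_eq_zero.1 (M.eq_zero_of_forall_rsmul fun x => by simp [h])

/-- An element acting positively is positive: testing against the negative part `n` of `a` gives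
`-n³`, whose action is both positive and negative. -/
theorem nonneg_of_forall_linner_lsmul {a : A} (ha : IsSelfAdjoint a)
    (h : ∀ x, 0 ≤ M.rinner x (M.lsmul a x)) : 0 ≤ a := by
  set n := a⁻ with hn
  have hn0 : 0 ≤ n := CFC.negPart_nonneg a
  have hns : star n = n := (IsSelfAdjoint.of_nonneg hn0).star_eq
  obtain ⟨k, hk⟩ := CStarAlgebra.nonneg_iff_eq_star_mul_self.1 hn0
  have hnan : n * a * n = -(star (k * n) * (k * n)) := by
    have h1 : a = a⁺ - n := (CFC.posPart_sub_negPart a ha).symm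
    have h2 : n * a⁺ = 0 := CFC.negPart_mul_posPart a
    rw [h1, mul_sub, h2, zero_sub, star_mul, hns, neg_mul, mul_assoc n (star k),
      ← mul_assoc (star k), ← hk]
    simp [mul_assoc]
  have hkn : k * n = 0 := M.eq_zero_of_forall_lsmul fun x => by
    have h1 : 0 ≤ M.rinner (M.lsmul n x) (M.lsmul a (M.lsmul n x)) := h _
    rw [M.rinner_lsmul_left, hns, ← M.lsmul_mul, ← M.lsmul_mul, hnan, map_neg,
      LinearMap.neg_apply, ← M.rinnerL_apply, map_neg, M.rinnerL_apply, M.lsmul_mul,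
      M.rinner_lsmul, star_star] at h1
    have h2 := le_antisymm (neg_nonneg.1 h1) (M.rinner_self_nonneg _)
    have h3 := M.norm_sq_eq_rinner (M.lsmul (k * n) x)
    rw [h2] at h3
    simpa using h3
  have hnn : star n * n = 0 := by
    rw [hns]
    nth_rewrite 1 [hk]
    rw [mul_assoc, hkn, mul_zero]
  have : n = 0 := CStarRing.star_mul_self_eq_zero_iff n |>.1 hnn
  rw [← CFC.posPart_sub_negPart a ha, ← hn, this, sub_zero]
  exact CFC.posPart_nonneg a

/-- The norm of a positive element is determined by its numerical values on `X`. For `N < N' < ‖a‖`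
the element `k = (a - N')₊` is nonzero, while `N' k² ≤ k a k` forces it to annihilate `X`. -/
theorem norm_le_of_forall_norm_rinner_le {a : A} (ha : 0 ≤ a) {N : ℝ} (hN : 0 ≤ N)
    (h : ∀ x, ‖M.rinner x (M.lsmul a x)‖ ≤ N * ‖x‖ ^ 2) : ‖a‖ ≤ N := by
  refine le_of_forall_gt_imp_ge_of_dense fun N' hN' => ?_
  have hN'0 : 0 < N' := hN.trans_lt hN'
  have has : IsSelfAdjoint a := IsSelfAdjoint.of_nonneg ha
  let f : ℝ → ℝ := fun t => max 0 (t - N')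
  have hf0 : f 0 = 0 := by simp [f, hN'0.le]
  have hfc : Continuous f := by fun_prop
  set k := cfcₙ f a with hk
  have hks : star k = k := (cfcₙ_predicate f a : IsSelfAdjoint k).star_eq
  have hpos : 0 ≤ k * a * k - (N' : ℂ) • (k * k) := by
    have h1 : k * a * k = cfcₙ (fun t => f t * t * f t) a := by
      rw [cfcₙ_mul (fun t => f t * t) f a, cfcₙ_mul f (fun t => t) a, cfcₙ_id' ℝ a]
    have h2 : (N' : ℂ) • (k * k) = cfcₙ (fun t => N' * (f t * f t)) a := by
      rw [cfcₙ_const_mul N' (fun t => f t * f t) a, cfcₙ_mul f f a, Complex.coe_smul]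
    rw [h1, h2, ← cfcₙ_sub (fun t => f t * t * f t) (fun t => N' * (f t * f t)) a
      (hf := by fun_prop) (hg := by fun_prop)]
    refine cfcₙ_nonneg fun t _ => ?_
    have : f t * t * f t - N' * (f t * f t) = (t - N') * (f t) ^ 2 := by ring
    rw [this]
    rcases le_total N' t with ht | ht
    · exact mul_nonneg (sub_nonneg.2 ht) (sq_nonneg _)
    · simp [f, ht]
  have hk0 : k = 0 := M.eq_zero_of_forall_lsmul fun x => by
    obtain ⟨g, hg⟩ := CStarAlgebra.nonneg_iff_eq_star_mul_self.1 hpos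
    have h1 : 0 ≤ M.rinner (M.lsmul k x) (M.lsmul a (M.lsmul k x)) -
        (N' : ℂ) • M.rinner (M.lsmul k x) (M.lsmul k x) := by
      have e : M.rinner (M.lsmul k x) (M.lsmul a (M.lsmul k x)) -
          (N' : ℂ) • M.rinner (M.lsmul k x) (M.lsmul k x) =
          M.rinner (M.lsmul g x) (M.lsmul g x) := by
        rw [M.rinner_lsmul_left, M.rinner_lsmul_left, hks, M.rinner_lsmul_left, ← M.lsmul_mul,
          ← M.lsmul_mul, ← M.lsmul_mul, ← M.lsmul_mul, ← hg, ← M.rinnerL_apply,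
          ← M.rinnerL_apply, ← M.rinnerL_apply, ← map_smul, ← map_sub]
        simp
      rw [e]
      exact M.rinner_self_nonneg _
    have h2 : ‖(N' : ℂ) • M.rinner (M.lsmul k x) (M.lsmul k x)‖ ≤
        ‖M.rinner (M.lsmul k x) (M.lsmul a (M.lsmul k x))‖ := by
      refine CStarAlgebra.norm_le_norm_of_nonneg_of_le ?_ (sub_nonneg.1 h1)
      rw [Complex.coe_smul]
      exact smul_nonneg hN'0.le (M.rinner_self_nonneg _)
    rw [norm_smul, ← M.norm_sq_eq_rinner] at h2
    have h3 := h2.trans (h _)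
    simp only [Complex.norm_real, Real.norm_eq_abs, abs_of_pos hN'0] at h3
    have h4 : ‖M.lsmul k x‖ ^ 2 ≤ 0 := by nlinarith [sq_nonneg ‖M.lsmul k x‖]
    simpa using le_antisymm h4 (sq_nonneg _)
  rw [← cfcₙ_id' ℝ a]
  refine norm_cfcₙ_le fun t ht => ?_
  have h1 : ‖f t‖ ≤ ‖k‖ := norm_apply_le_norm_cfcₙ f a ht
  have ht0 : 0 ≤ t := quasispectrum_nonneg_of_nonneg a ha t ht
  rw [hk0, norm_zero, norm_le_zero_iff] at h1
  have : t - N' ≤ 0 := by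
    rw [← h1]; exact le_max_right _ _
  rw [Real.norm_eq_abs, abs_of_nonneg ht0]
  linarith

/-- The left action is isometric. -/
theorem norm_le_of_forall_norm_lsmul_le {a : A} {N : ℝ} (hN : 0 ≤ N)
    (h : ∀ x, ‖M.lsmul a x‖ ≤ N * ‖x‖) : ‖a‖ ≤ N := by
  refine le_of_sq_le_sq ?_ hN
  rw [sq ‖a‖, ← CStarRing.norm_star_mul_self]
  refine M.norm_le_of_forall_norm_rinner_le (star_mul_self_nonneg a) (by positivity) fun x => ?_
  rw [M.lsmul_mul, M.rinner_lsmul, star_star, ← M.norm_sq_eq_rinner, ← mul_pow]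
  gcongr
  exact h x

/-- The left action as an isometric linear map into the bounded operators. -/
noncomputable def lsmulIsometry : A →ₗᵢ[ℂ] X →L[ℂ] X where
  toLinearMap := M.lsmulL
  norm_map' a := le_antisymm
    (ContinuousLinearMap.opNorm_le_bound _ (norm_nonneg _) fun x => M.norm_lsmul_le a x)
    (M.norm_le_of_forall_norm_lsmul_le (norm_nonneg _) fun x => (M.lsmulL a).le_opNorm x)

/-- The right action as an isometric linear map into the bounded operators. -/
noncomputable def rsmulIsometry : B →ₗᵢ[ℂ] X →L[ℂ] X where
  toLinearMap := M.rsmulL.flip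
  norm_map' b := by
    refine le_antisymm (ContinuousLinearMap.opNorm_le_bound _ (norm_nonneg _) fun x =>
      (M.norm_rsmul_le x b).trans_eq (mul_comm _ _)) ?_
    rw [← norm_star b]
    refine M.reverse.norm_le_of_forall_norm_lsmul_le (norm_nonneg _) fun x => ?_
    have := (M.rsmulL.flip b).le_opNorm ((conj X).symm x)
    rw [LinearIsometryEquiv.norm_map] at this
    change ‖conj X (M.rsmul ((conj X).symm x) (star (star b)))‖ ≤ _
    rw [star_star, LinearIsometryEquiv.norm_map]
    exact this

theorem lsmulIsometry_apply (a : A) (x : X) : M.lsmulIsometry a x = M.lsmul a x := rfl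
theorem rsmulIsometry_apply (b : B) (x : X) : M.rsmulIsometry b x = M.rsmul x b := rfl

/-- The inner products of `I · X` span a dense subspace of `I`: they contain the products `a c a'`
with `a`, `a'` in `I` and `c` an inner product of `X`. -/
theorem closure_span_linner_idealMul (I : ClosedIdeal A) :
    closure (Submodule.span ℂ {a | ∃ x ∈ M.idealMul I, ∃ y ∈ M.idealMul I,
      a = M.linner x y} : Set A) = {a | a ∈ I} := by
  refine subset_antisymm (closure_minimal (Submodule.span_le (p := I.toSubmodule).2 ?_)
    I.isClosed) ?_
  · rintro _ ⟨x, hx, y, -, rfl⟩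
    exact M.linner_mem_of_mem_left hx y
  · set N := (Submodule.span ℂ {a | ∃ x ∈ M.idealMul I, ∃ y ∈ M.idealMul I,
      a = M.linner x y}).topologicalClosure with hN
    have hNc : IsClosed (N : Set A) := Submodule.isClosed_topologicalClosure _
    have h1 : ∀ a ∈ I, ∀ a' ∈ I, ∀ c, a * c * a' ∈ N := fun a ha a' ha' => by
      refine M.linner_induction
        (N := N.comap ((LinearMap.mulRight ℂ a').comp (LinearMap.mulLeft ℂ a)))
        (hNc.preimage ((continuous_mul_const a').comp (continuous_const_mul a))) fun x y => ?_
      refine Submodule.le_topologicalClosure _ (Submodule.subset_span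
        ⟨M.lsmul a x, M.lsmul_mem_idealMul ha x, M.lsmul (star a') y,
          M.lsmul_mem_idealMul (ClosedIdeal.star_mem ha') y, ?_⟩)
      simp [M.linner_lsmul, M.linner_lsmul_right, mul_assoc]
    obtain ⟨l, hl, hmem, -, -, h2⟩ := I.exists_approximateUnit
    intro a ha
    refine hNc.mem_of_tendsto (h2 a ha) ?_
    filter_upwards [hmem] with e he
    refine hNc.mem_of_tendsto ((h2 a ha).mul_const e) ?_
    filter_upwards with e' using h1 a ha e he e'

theorem closure_span_rinner_mulIdeal (J : ClosedIdeal B) :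
    closure (Submodule.span ℂ {b | ∃ x ∈ M.mulIdeal J, ∃ y ∈ M.mulIdeal J,
      b = M.rinner x y} : Set B) = {b | b ∈ J} := by
  rw [← M.reverse.closure_span_linner_idealMul J]
  congr 3
  ext b
  constructor
  · rintro ⟨x, hx, y, hy, rfl⟩
    exact ⟨conj X x, M.conj_mem_reverse_idealMul.2 hx, conj X y,
      M.conj_mem_reverse_idealMul.2 hy, rfl⟩
  · rintro ⟨x, hx, y, hy, rfl⟩
    exact ⟨(conj X).symm x, M.conj_mem_reverse_idealMul.1 hx, (conj X).symm y,
      M.conj_mem_reverse_idealMul.1 hy, rfl⟩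

theorem isSubbimodule (h : M.idealMul I = M.mulIdeal J) :
    M.IsSubbimodule I (M.idealMul I) J where
  isClosed := M.isClosed_idealMul
  lsmul_mem a _ hy := M.lsmul_mem a hy
  rsmul_mem b _ hy := M.rsmul_mem_idealMul b hy
  closure_linner := M.closure_span_linner_idealMul I
  closure_rinner := by
    rw [h]
    exact M.closure_span_rinner_mulIdeal J

end ImprimitivityBimodule

/-! ### Isometric graphs -/

section Graph

variable {E F : Type*} [NormedAddCommGroup E] [NormedSpace ℂ E] [CompleteSpace E]
  [NormedAddCommGroup F] [NormedSpace ℂ F]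

/-- If `f` is isometric on the closure of `G`, the image of this closure contains the closure of the
image of `G`. With `G` a linear relation and `f` a projection, this extends isometric relations by
continuity. -/
theorem Submodule.exists_mem_topologicalClosure_of_isometric (G : Submodule ℂ E) (f : E →ₗ[ℂ] F)
    (h : ∀ p ∈ G.topologicalClosure, ‖f p‖ = ‖p‖) {y : F}
    (hy : y ∈ (G.map f).topologicalClosure) : ∃ p ∈ G.topologicalClosure, f p = y := by
  let g : G.topologicalClosure →ₗ[ℂ] F := f.domRestrict _
  have hg : Isometry g := AddMonoidHomClass.isometry_of_norm g fun p => h _ p.2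
  have : CompleteSpace G.topologicalClosure :=
    (Submodule.isClosed_topologicalClosure G).completeSpace_coe
  have hcl : IsClosed (LinearMap.range g : Set F) := by
    rw [LinearMap.coe_range]
    exact hg.isClosedEmbedding.isClosed_range
  have hle : G.map f ≤ LinearMap.range g := by
    rintro _ ⟨p, hp, rfl⟩
    exact ⟨⟨p, G.le_topologicalClosure hp⟩, rfl⟩
  obtain ⟨p, rfl⟩ := Submodule.topologicalClosure_minimal _ hle hcl hy
  exact ⟨p, p.2, rfl⟩

end Graph

theorem Submodule.topologicalClosure_span_le {E : Type*} [NormedAddCommGroup E] [NormedSpace ℂ E]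
    {s : Set E} {N : Submodule ℂ E}
    (hN : IsClosed (N : Set E)) (h : s ⊆ N) : (Submodule.span ℂ s).topologicalClosure ≤ N :=
  Submodule.topologicalClosure_minimal _ (Submodule.span_le.2 h) hN

namespace HilbertBimodule

variable {A B X : Type u}
  [NonUnitalCStarAlgebra A] [PartialOrder A] [StarOrderedRing A]
  [NonUnitalCStarAlgebra B] [PartialOrder B] [StarOrderedRing B]
  [NormedAddCommGroup X] [NormedSpace ℂ X] [CompleteSpace X]
  (M : HilbertBimodule A B X) {I : ClosedIdeal A} {J : ClosedIdeal B}

/-- If the right inner products of a set of pairs are related by a closed relation, so are those of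
the closed span of the set. -/
theorem rinner_mem_of_mem_closure_span {Γ : Submodule ℂ (B × B)} (hΓ : IsClosed (Γ : Set (B × B)))
    (hstar : ∀ p ∈ Γ, star p ∈ Γ) {S : Set (X × X)}
    (h : ∀ p ∈ S, ∀ q ∈ S, (M.rinner p.1 q.1, M.rinner p.2 q.2) ∈ Γ) {p q : X × X}
    (hp : p ∈ (Submodule.span ℂ S).topologicalClosure)
    (hq : q ∈ (Submodule.span ℂ S).topologicalClosure) :
    (M.rinner p.1 q.1, M.rinner p.2 q.2) ∈ Γ := by
  have key : ∀ p : X × X, (∀ q ∈ S, (M.rinner p.1 q.1, M.rinner p.2 q.2) ∈ Γ) →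
      ∀ q ∈ (Submodule.span ℂ S).topologicalClosure,
        (M.rinner p.1 q.1, M.rinner p.2 q.2) ∈ Γ := fun p hp q hq => by
    let L := (M.rinnerL p.1).prodMap (M.rinnerL p.2)
    exact Submodule.topologicalClosure_span_le (N := Γ.comap (L : X × X →ₗ[ℂ] B × B))
      (hΓ.preimage L.continuous) hp hq
  have swap : ∀ p q : X × X, (M.rinner p.1 q.1, M.rinner p.2 q.2) ∈ Γ →
      (M.rinner q.1 p.1, M.rinner q.2 p.2) ∈ Γ := fun p q hpq => by
    have := hstar _ hpq
    rwa [Prod.star_def, M.star_rinner, M.star_rinner] at this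
  exact key p (fun q hq => swap _ _ (key q (h q hq) p hp)) q hq

theorem linner_mem_of_mem_closure_span {Γ : Submodule ℂ (A × A)} (hΓ : IsClosed (Γ : Set (A × A)))
    (hstar : ∀ p ∈ Γ, star p ∈ Γ) {S : Set (X × X)}
    (h : ∀ p ∈ S, ∀ q ∈ S, (M.linner p.1 q.1, M.linner p.2 q.2) ∈ Γ) {p q : X × X}
    (hp : p ∈ (Submodule.span ℂ S).topologicalClosure)
    (hq : q ∈ (Submodule.span ℂ S).topologicalClosure) :
    (M.linner p.1 q.1, M.linner p.2 q.2) ∈ Γ := by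
  have key : ∀ q : X × X, (∀ p ∈ S, (M.linner p.1 q.1, M.linner p.2 q.2) ∈ Γ) →
      ∀ p ∈ (Submodule.span ℂ S).topologicalClosure,
        (M.linner p.1 q.1, M.linner p.2 q.2) ∈ Γ := fun q hq p hp => by
    let L : X × X →L[ℂ] A × A := (M.linnerL.flip q.1).prodMap (M.linnerL.flip q.2)
    exact Submodule.topologicalClosure_span_le (N := Γ.comap (L : X × X →ₗ[ℂ] A × A))
      (hΓ.preimage L.continuous) hq hp
  have swap : ∀ p q : X × X, (M.linner p.1 q.1, M.linner p.2 q.2) ∈ Γ →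
      (M.linner q.1 p.1, M.linner q.2 p.2) ∈ Γ := fun p q hpq => by
    have := hstar _ hpq
    rwa [Prod.star_def, M.star_linner, M.star_linner] at this
  exact key q (fun p hp => swap _ _ (key p (fun q hq => h q hq p hp) q hq)) p hp

/-! ### Multiples by unitary multipliers -/

/-- The pairs `(a · x, (m a) · x)`, whose closed span is the graph of multiplication by `m`. -/
def multiplePairs (m : I.Mult) : Set (X × X) :=
  {p | ∃ (a : I.Elem) (x : X), p = (M.lsmul a x, M.lsmul (ClosedIdeal.mulLeft m a) x)}

theorem isLeftMultiple_of_mem_closure_span {m : I.Mult} {y z : X}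
    (h : (y, z) ∈ (Submodule.span ℂ (M.multiplePairs m)).topologicalClosure) :
    M.IsLeftMultiple m y z := by
  refine ⟨?_, ?_, fun a => ?_⟩
  · refine Submodule.topologicalClosure_span_le
      (N := (M.idealMul I).comap (LinearMap.fst ℂ X X))
      (M.isClosed_idealMul.preimage continuous_fst) ?_ h
    rintro _ ⟨a, x, rfl⟩
    exact M.lsmul_mem_idealMul a.2 x
  · refine Submodule.topologicalClosure_span_le
      (N := (M.idealMul I).comap (LinearMap.snd ℂ X X))
      (M.isClosed_idealMul.preimage continuous_snd) ?_ h
    rintro _ ⟨a, x, rfl⟩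
    exact M.lsmul_mem_idealMul (ClosedIdeal.mulLeft m a).2 x
  · let L : X × X →L[ℂ] X := (M.lsmulL a).comp (ContinuousLinearMap.snd ℂ X X) -
      (M.lsmulL (ClosedIdeal.mulRight a m)).comp (ContinuousLinearMap.fst ℂ X X)
    have : (y, z) ∈ LinearMap.ker (L : X × X →ₗ[ℂ] X) := by
      refine Submodule.topologicalClosure_span_le
        (isClosed_singleton.preimage L.continuous) ?_ h
      rintro _ ⟨c, x, rfl⟩
      change M.lsmul a (M.lsmul (ClosedIdeal.mulLeft m c) x) -
        M.lsmul (ClosedIdeal.mulRight a m) (M.lsmul c x) = 0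
      rw [← M.lsmul_mul, ← M.lsmul_mul, sub_eq_zero]
      congr 2
      exact (congrArg Subtype.val (ClosedIdeal.mulRight_mul a c m)).symm
    exact sub_eq_zero.1 (show M.lsmul a z - M.lsmul (ClosedIdeal.mulRight a m) y = 0 from this)

/-- Multiplication by a unitary multiplier exists on `I · X`, because it preserves the right inner
products of the elements `a · x`. -/
theorem exists_mem_closure_span_multiplePairs (m : unitary I.Mult) {y : X}
    (hy : y ∈ M.idealMul I) :
    ∃ z, (y, z) ∈ (Submodule.span ℂ (M.multiplePairs (m : I.Mult))).topologicalClosure := by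
  let Γ : Submodule ℂ (B × B) := LinearMap.ker (LinearMap.fst ℂ B B - LinearMap.snd ℂ B B)
  have hΓ : ∀ p : B × B, p ∈ Γ ↔ p.1 = p.2 := fun p => by
    simp [Γ, sub_eq_zero]
  suffices h : ∃ p ∈ (Submodule.span ℂ (M.multiplePairs (m : I.Mult))).topologicalClosure,
      LinearMap.fst ℂ X X p = y by
    obtain ⟨p, hp, rfl⟩ := h
    exact ⟨p.2, hp⟩
  refine Submodule.exists_mem_topologicalClosure_of_isometric _ _ (fun p hp => ?_) ?_
  · have := M.rinner_mem_of_mem_closure_span (Γ := Γ)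
      (isClosed_singleton.preimage (continuous_fst.sub continuous_snd))
      (fun p hp => (hΓ _).2 (congrArg star ((hΓ _).1 hp))) ?_ hp hp
    · have h1 : M.rinner p.1 p.1 = M.rinner p.2 p.2 := (hΓ _).1 this
      have h2 : ‖p.2‖ ^ 2 = ‖p.1‖ ^ 2 := by
        rw [M.norm_sq_eq_rinner, M.norm_sq_eq_rinner, h1]
      change ‖p.1‖ = max ‖p.1‖ ‖p.2‖
      rw [(sq_eq_sq₀ (norm_nonneg _) (norm_nonneg _)).1 h2, max_self]
    · rintro _ ⟨a, x, rfl⟩ _ ⟨c, y, rfl⟩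
      rw [hΓ]
      change M.rinner (M.lsmul a x) (M.lsmul c y) =
        M.rinner (M.lsmul (ClosedIdeal.mulLeft (m : I.Mult) a) x)
          (M.lsmul (ClosedIdeal.mulLeft (m : I.Mult) c) y)
      rw [M.rinner_lsmul_left, M.rinner_lsmul_left, ← M.lsmul_mul, ← M.lsmul_mul]
      congr 3
      have : star (ClosedIdeal.mulLeft (m : I.Mult) a) * ClosedIdeal.mulLeft (m : I.Mult) c =
          star a * c := by
        rw [ClosedIdeal.star_mulLeft, ClosedIdeal.mulRight_mul, ClosedIdeal.mulLeft_mulLeft,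
          Unitary.coe_star_mul_self, ClosedIdeal.mulLeft_one]
      exact (congrArg Subtype.val this).symm
  · refine Submodule.topologicalClosure_mono (Submodule.span_le.2 ?_) hy
    rintro _ ⟨a, ha, x, rfl⟩
    exact ⟨_, Submodule.subset_span ⟨⟨a, ha⟩, x, rfl⟩, rfl⟩

theorem IsLeftMultiple.unique {M : HilbertBimodule A B X} {m : I.Mult} {y z z' : X}
    (h : M.IsLeftMultiple m y z) (h' : M.IsLeftMultiple m y z') : z = z' :=
  M.eq_of_forall_lsmul h.2.1 h'.2.1 fun a ha => (h.2.2 ⟨a, ha⟩).trans (h'.2.2 ⟨a, ha⟩).symm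

theorem IsLeftMultiple.mem_closure_span {M : HilbertBimodule A B X} {m : unitary I.Mult} {y z : X}
    (h : M.IsLeftMultiple (m : I.Mult) y z) :
    (y, z) ∈ (Submodule.span ℂ (M.multiplePairs (m : I.Mult))).topologicalClosure := by
  obtain ⟨z', hz'⟩ := M.exists_mem_closure_span_multiplePairs m h.1
  rwa [h.unique (M.isLeftMultiple_of_mem_closure_span hz')]

theorem exists_isLeftMultiple (m : unitary I.Mult) {y : X} (hy : y ∈ M.idealMul I) :
    ∃ z, M.IsLeftMultiple (m : I.Mult) y z :=
  (M.exists_mem_closure_span_multiplePairs m hy).imp fun _ h =>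
    M.isLeftMultiple_of_mem_closure_span h

open ConjSpace

theorem exists_isRightMultiple (m : unitary J.Mult) {y : X} (hy : y ∈ M.mulIdeal J) :
    ∃ z, M.IsRightMultiple y (m : J.Mult) z := by
  obtain ⟨z, hz⟩ := M.reverse.exists_isLeftMultiple (star m) (M.conj_mem_reverse_idealMul.2 hy)
  refine ⟨(conj X).symm z, hy, M.conj_mem_reverse_idealMul.1 hz.2.1, fun b => ?_⟩
  have := hz.2.2 (star b)
  rw [Unitary.coe_star, ← ClosedIdeal.star_mulLeft] at this
  have h2 := congrArg (conj X).symm this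
  change M.rsmul ((conj X).symm z) (star (star (b : B))) =
    M.rsmul y (star (star (ClosedIdeal.mulLeft (m : J.Mult) b : B))) at h2
  rwa [star_star, star_star] at h2

/-- `w = u · y · v*`, expressed by testing with `I` and `J` on both sides. In this form the
condition is symmetric in left and right and involves bounded operations only. -/
theorem exists_isLeftMultiple_isRightMultiple_iff (h : M.idealMul I = M.mulIdeal J)
    (m : unitary I.Mult) (n : unitary J.Mult) (y w : X) :
    (∃ z, M.IsLeftMultiple (m : I.Mult) y z ∧ M.IsRightMultiple z (n : J.Mult) w) ↔
      y ∈ M.idealMul I ∧ w ∈ M.idealMul I ∧ ∀ (a : I.Elem) (b : J.Elem),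
        M.lsmul a (M.rsmul w b) = M.lsmul (ClosedIdeal.mulRight a (m : I.Mult))
          (M.rsmul y (ClosedIdeal.mulLeft (n : J.Mult) b)) := by
  constructor
  · rintro ⟨z, hz, hw⟩
    refine ⟨hz.1, h ▸ hw.2.1, fun a b => ?_⟩
    rw [hw.2.2, M.lsmul_rsmul, hz.2.2, M.lsmul_rsmul]
  · rintro ⟨hy, hw, heq⟩
    obtain ⟨z, hz⟩ := M.exists_isLeftMultiple m hy
    refine ⟨z, hz, h ▸ hz.2.1, h ▸ hw, fun b => ?_⟩
    refine M.eq_of_forall_lsmul (M.rsmul_mem_idealMul _ hw) (M.rsmul_mem_idealMul _ hz.2.1)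
      fun a ha => ?_
    rw [heq ⟨a, ha⟩ b, M.lsmul_rsmul, ← hz.2.2, ← M.lsmul_rsmul]

/-- The products `(u · y) · v*` and `u · (y · v*)` agree. -/
theorem exists_isRightMultiple_isLeftMultiple (h : M.idealMul I = M.mulIdeal J)
    {m : unitary I.Mult} {n : unitary J.Mult} {y w z : X}
    (hz : M.IsLeftMultiple (m : I.Mult) y z) (hw : M.IsRightMultiple z (n : J.Mult) w) :
    ∃ z', M.IsRightMultiple y (n : J.Mult) z' ∧ M.IsLeftMultiple (m : I.Mult) z' w := by
  obtain ⟨z', hz'⟩ := M.exists_isRightMultiple n (h ▸ hz.1)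
  refine ⟨z', hz', h ▸ hz'.2.1, h ▸ hw.2.1, fun a => ?_⟩
  refine M.eq_of_forall_rsmul (M.lsmul_mem_mulIdeal _ hw.2.1) (M.lsmul_mem_mulIdeal _ hz'.2.1)
    fun b hb => ?_
  rw [← M.lsmul_rsmul, ← M.lsmul_rsmul, hw.2.2 ⟨b, hb⟩, hz'.2.2 ⟨b, hb⟩, M.lsmul_rsmul, hz.2.2,
    M.lsmul_rsmul]

end HilbertBimodule

/-! ### Building Morita equivalences -/

/-- Morita equivalences from partial automorphisms: the equality of domains is automatic, because
`X_s` consists of the `x` with `_A⟨x, x⟩ ∈ A_s`, and the twisted multiplicativity may be tested with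
the ideals on both sides. -/
def TwistedMoritaEquivalence.ofPartialAut {S : Type v} [InverseMonoid S]
    {P Q : TwistedSystem.{u, v} S} {X : Type u} [NormedAddCommGroup X] [NormedSpace ℂ X]
    [CompleteSpace X] (M : ImprimitivityBimodule P.Alg Q.Alg X)
    (hM : ∀ s : S, M.idealMul (P.action.ideal s) = M.mulIdeal (Q.action.ideal s))
    (φ : ∀ s : S, M.idealMul (P.action.ideal s⁻¹) → M.idealMul (P.action.ideal s))
    (hφ : ∀ s : S, M.IsPartialAut (P.action.aut s) (φ s) (Q.action.aut s))
    (hcomp : ∀ (s t : S) (x : X) (h : x ∈ M.idealMul (P.action.ideal t⁻¹))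
      (h' : (φ t ⟨x, h⟩ : X) ∈ M.idealMul (P.action.ideal s⁻¹))
      (h'' : x ∈ M.idealMul (P.action.ideal (s * t)⁻¹))
      (a : (P.action.ideal (s * t)).Elem) (b : (Q.action.ideal (s * t)).Elem),
      M.lsmul a (M.rsmul (φ s ⟨φ t ⟨x, h⟩, h'⟩ : X) b) =
        M.lsmul (ClosedIdeal.mulRight a (P.action.cocycle s t : (P.action.ideal (s * t)).Mult))
          (M.rsmul (φ (s * t) ⟨x, h''⟩ : X) (ClosedIdeal.mulLeft
            (star (Q.action.cocycle s t : (Q.action.ideal (s * t)).Mult)) b))) :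
    TwistedMoritaEquivalence P Q where
  X := X
  bimodule := M
  idealMul_eq := hM
  map := φ
  isPartialAut := hφ
  mem_domain_comp s t x := by
    have hα : ∀ h : x ∈ M.idealMul (P.action.ideal t⁻¹),
        (P.action.aut t ⟨M.linner x x, M.mem_idealMul_iff.1 h⟩ : P.Alg) =
          M.linner (φ t ⟨x, h⟩) (φ t ⟨x, h⟩) := fun h =>
      (hφ t).map_linner ⟨x, h⟩ ⟨x, h⟩ _ rfl
    refine Iff.trans ?_ ((P.action.mem_domain_comp s t _).trans M.mem_idealMul_iff.symm)
    constructor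
    · rintro ⟨h, h'⟩
      refine ⟨M.mem_idealMul_iff.1 h, ?_⟩
      rw [hα h]
      exact M.mem_idealMul_iff.1 h'
    · rintro ⟨h, h'⟩
      refine ⟨M.mem_idealMul_iff.2 h, M.mem_idealMul_iff.2 ?_⟩
      rwa [← hα (M.mem_idealMul_iff.2 h)]
  comp_eq s t x h h' h'' := by
    refine (M.exists_isLeftMultiple_isRightMultiple_iff (hM _) _
      (star (Q.action.cocycle s t)) _ _).2
      ⟨(φ (s * t) ⟨x, h''⟩).2, M.mem_idealMul_iff.2 ?_, hcomp s t x h h' h''⟩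
    have hα := (hφ t).map_linner ⟨x, h⟩ ⟨x, h⟩ ⟨M.linner x x, M.mem_idealMul_iff.1 h⟩ rfl
    have hmem : (P.action.aut t ⟨M.linner x x, M.mem_idealMul_iff.1 h⟩ : P.Alg) ∈
        P.action.ideal s⁻¹ := by
      rw [hα]
      exact M.mem_idealMul_iff.1 h'
    rw [← (hφ s).map_linner ⟨_, h'⟩ ⟨_, h'⟩ ⟨_, hmem⟩ hα,
      P.action.comp_eq s t _ _ hmem (M.mem_idealMul_iff.1 h'')]
    exact Subtype.mem _

/-! ### Reflexivity -/

theorem closure_span_eq_univ_of_mul {A : Type u} [NonUnitalCStarAlgebra A] {S : Set A}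
    (hS : ∀ x y, x * y ∈ S) :
    closure (Submodule.span ℂ S : Set A) = Set.univ := by
  refine Set.eq_univ_of_forall fun a => ?_
  obtain ⟨l, hl, -, -, -, h⟩ := (ClosedIdeal.whole A).exists_approximateUnit
  exact mem_closure_of_tendsto (h a trivial)
    (Eventually.of_forall fun e => Submodule.subset_span (hS _ _))

section Refl

variable (A : Type u) [NonUnitalCStarAlgebra A] [PartialOrder A] [StarOrderedRing A]

/-- A C⋆-algebra as a Hilbert bimodule over itself. -/
noncomputable def HilbertBimodule.self : HilbertBimodule A A A where
  lsmul := LinearMap.mul ℂ A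
  rsmul := LinearMap.mul ℂ A
  linner x y := x * star y
  rinner x y := star x * y
  lsmul_mul := mul_assoc
  rsmul_mul x b b' := (mul_assoc x b b').symm
  lsmul_rsmul a x b := (mul_assoc a x b).symm
  rinner_linear c d x y z := by simp [mul_add, mul_smul_comm]
  rinner_rsmul x y b := (mul_assoc _ _ _).symm
  star_rinner x y := by simp
  rinner_self_nonneg := star_mul_self_nonneg
  norm_sq_eq_rinner x := by rw [CStarRing.norm_star_mul_self, sq]
  linner_linear c d x y z := by simp [add_mul, smul_mul_assoc]
  linner_lsmul a x y := mul_assoc _ _ _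
  star_linner x y := by simp
  linner_self_nonneg := mul_star_self_nonneg
  norm_sq_eq_linner x := by rw [CStarRing.norm_self_mul_star, sq]
  linner_lsmul_eq x y z := mul_assoc _ _ _

/-- A C⋆-algebra as an imprimitivity bimodule over itself. -/
noncomputable def ImprimitivityBimodule.self : ImprimitivityBimodule A A A where
  toHilbertBimodule := HilbertBimodule.self A
  full_left := closure_span_eq_univ_of_mul fun x y => ⟨x, star y, by
    simp [HilbertBimodule.self]⟩
  full_right := closure_span_eq_univ_of_mul fun x y => ⟨star x, y, by
    simp [HilbertBimodule.self]⟩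

variable {A}

theorem ImprimitivityBimodule.mem_self_idealMul {I : ClosedIdeal A} {x : A} :
    x ∈ (ImprimitivityBimodule.self A).idealMul I ↔ x ∈ I :=
  ⟨fun h => HilbertBimodule.idealMul_le (HilbertBimodule.self A) (N := I.toSubmodule)
    I.isClosed_toSubmodule
    (fun _ ha y => I.mul_mem_right y ha) h,
    fun h => (HilbertBimodule.mem_idealMul_iff _).2 (I.mul_mem_right _ h)⟩

theorem ImprimitivityBimodule.mem_self_mulIdeal {I : ClosedIdeal A} {x : A} :
    x ∈ (ImprimitivityBimodule.self A).mulIdeal I ↔ x ∈ I :=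
  ⟨fun h => HilbertBimodule.mulIdeal_le (HilbertBimodule.self A) (N := I.toSubmodule)
    I.isClosed_toSubmodule
    (fun y _ hb => I.mul_mem_left y hb) h,
    fun h => (HilbertBimodule.mem_mulIdeal_iff _).2 (I.mul_mem_left _ h)⟩

open ImprimitivityBimodule in
/-- Every twisted action is Morita equivalent to itself via `(A, α)`. -/
noncomputable def TwistedMoritaEquivalence.refl {S : Type v} [InverseMonoid S]
    (P : TwistedSystem.{u, v} S) : TwistedMoritaEquivalence P P :=
  .ofPartialAut (ImprimitivityBimodule.self P.Alg)
    (fun s => Submodule.ext fun x => mem_self_idealMul.trans mem_self_mulIdeal.symm)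
    (fun s x => ⟨P.action.aut s ⟨x, mem_self_idealMul.1 x.2⟩,
      mem_self_idealMul.2 (Subtype.mem _)⟩)
    (fun s =>
      { source := isSubbimodule _ (Submodule.ext fun x =>
          mem_self_idealMul.trans mem_self_mulIdeal.symm)
        target := isSubbimodule _ (Submodule.ext fun x =>
          mem_self_idealMul.trans mem_self_mulIdeal.symm)
        map_rsmul := fun x y b h => by
          have : (⟨y, mem_self_idealMul.1 y.2⟩ : (P.action.ideal s⁻¹).Elem) =
            ⟨x, mem_self_idealMul.1 x.2⟩ * b := Subtype.ext h
          simp only [this, map_mul]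
          rfl
        map_rinner := fun x y b h => by
          have : b = star (⟨x, mem_self_idealMul.1 x.2⟩ : (P.action.ideal s⁻¹).Elem) *
            ⟨y, mem_self_idealMul.1 y.2⟩ := Subtype.ext h
          simp only [this, map_mul, map_star]
          rfl
        map_lsmul := fun x y a h => by
          have : (⟨y, mem_self_idealMul.1 y.2⟩ : (P.action.ideal s⁻¹).Elem) =
            a * ⟨x, mem_self_idealMul.1 x.2⟩ := Subtype.ext h
          simp only [this, map_mul]
          rfl
        map_linner := fun x y a h => by
          have : a = (⟨x, mem_self_idealMul.1 x.2⟩ : (P.action.ideal s⁻¹).Elem) *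
            star ⟨y, mem_self_idealMul.1 y.2⟩ := Subtype.ext h
          simp only [this, map_mul, map_star]
          rfl
        surjective := fun y => by
          obtain ⟨x, hx⟩ := (P.action.aut s).surjective ⟨y, mem_self_idealMul.1 y.2⟩
          refine ⟨⟨x, mem_self_idealMul.2 x.2⟩, Subtype.ext ?_⟩
          change (P.action.aut s x : P.Alg) = y
          rw [show P.action.aut s x = _ from hx] })
    (fun s t x h h' h'' a b => by
      change (a : P.Alg) * ((P.action.aut s ⟨P.action.aut t ⟨x, _⟩, _⟩ : P.Alg) * b) =
        (ClosedIdeal.mulRight a _ : P.Alg) * ((P.action.aut (s * t) ⟨x, _⟩ : P.Alg) *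
          ClosedIdeal.mulLeft _ b)
      rw [P.action.comp_eq s t x _ _ (mem_self_idealMul.1 h'')]
      norm_cast
      rw [ClosedIdeal.mulRight_mul, ClosedIdeal.mulRight_mul, ClosedIdeal.mulLeft_mul])

end Refl

/-! ### Symmetry -/

section Symm

open ConjSpace

variable {S : Type v} [InverseMonoid S] {P Q : TwistedSystem.{u, v} S}

namespace TwistedMoritaEquivalence

variable (E : TwistedMoritaEquivalence P Q)

theorem conj_mem_reverse_idealMul_iff {x : E.X} {s : S} :
    conj E.X x ∈ E.bimodule.reverse.idealMul (Q.action.ideal s) ↔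
      x ∈ E.bimodule.idealMul (P.action.ideal s) :=
  E.bimodule.conj_mem_reverse_idealMul.trans (by rw [E.idealMul_eq])

theorem reverse_idealMul_eq (s : S) :
    E.bimodule.reverse.idealMul (Q.action.ideal s) =
      E.bimodule.reverse.mulIdeal (P.action.ideal s) :=
  Submodule.ext fun x => (E.conj_mem_reverse_idealMul_iff (x := (conj E.X).symm x)).trans
    (E.bimodule.conj_mem_reverse_mulIdeal (x := (conj E.X).symm x)).symm

/-- `φ~_s (x~) = φ_s(x)~`. -/
noncomputable def reverseMap (s : S)
    (x : E.bimodule.reverse.idealMul (Q.action.ideal s⁻¹)) :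
    E.bimodule.reverse.idealMul (Q.action.ideal s) :=
  ⟨conj E.X (E.map s ⟨(conj E.X).symm x, E.conj_mem_reverse_idealMul_iff.1 x.2⟩),
    E.conj_mem_reverse_idealMul_iff.2 (Subtype.mem _)⟩

/-- The reverse of a Morita equivalence. -/
noncomputable def reverse : TwistedMoritaEquivalence Q P :=
  .ofPartialAut E.bimodule.reverse E.reverse_idealMul_eq E.reverseMap
    (fun s =>
      { source := ImprimitivityBimodule.isSubbimodule _ (E.reverse_idealMul_eq _)
        target := ImprimitivityBimodule.isSubbimodule _ (E.reverse_idealMul_eq _)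
        map_rsmul := fun x y a h => by
          have := (E.isPartialAut s).map_lsmul
            ⟨_, E.conj_mem_reverse_idealMul_iff.1 x.2⟩ ⟨_, E.conj_mem_reverse_idealMul_iff.1 y.2⟩
            (star a) (congrArg (conj E.X).symm h)
          rw [map_star] at this
          exact congrArg (conj E.X) this
        map_rinner := fun x y a h => (E.isPartialAut s).map_linner
          ⟨_, E.conj_mem_reverse_idealMul_iff.1 x.2⟩ ⟨_, E.conj_mem_reverse_idealMul_iff.1 y.2⟩ a h
        map_lsmul := fun x y b h => by
          have := (E.isPartialAut s).map_rsmul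
            ⟨_, E.conj_mem_reverse_idealMul_iff.1 x.2⟩ ⟨_, E.conj_mem_reverse_idealMul_iff.1 y.2⟩
            (star b) (congrArg (conj E.X).symm h)
          rw [map_star] at this
          exact congrArg (conj E.X) this
        map_linner := fun x y b h => (E.isPartialAut s).map_rinner
          ⟨_, E.conj_mem_reverse_idealMul_iff.1 x.2⟩ ⟨_, E.conj_mem_reverse_idealMul_iff.1 y.2⟩ b h
        surjective := fun y => by
          obtain ⟨x, hx⟩ := (E.isPartialAut s).surjective
            ⟨_, E.conj_mem_reverse_idealMul_iff.1 y.2⟩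
          refine ⟨⟨conj E.X x, E.conj_mem_reverse_idealMul_iff.2 x.2⟩, Subtype.ext ?_⟩
          exact congrArg (fun z => conj E.X (Subtype.val z)) hx })
    (fun s t x h h' h'' b a => by
      have := ((E.bimodule.exists_isLeftMultiple_isRightMultiple_iff (E.idealMul_eq _) _
        (star (Q.action.cocycle s t)) _ _).1 (E.comp_eq s t ((conj E.X).symm x)
          (E.conj_mem_reverse_idealMul_iff.1 h) (E.conj_mem_reverse_idealMul_iff.1 h')
          (E.conj_mem_reverse_idealMul_iff.1 h''))).2.2 (star a) (star b)
      rw [Unitary.coe_star, E.bimodule.lsmul_rsmul, E.bimodule.lsmul_rsmul] at this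
      refine (congrArg (conj E.X) this).trans ?_
      have h1 := ClosedIdeal.star_mulLeft a
        (star (P.action.cocycle s t : (P.action.ideal (s * t)).Mult))
      have h2 := ClosedIdeal.star_mulRight b
        (Q.action.cocycle s t : (Q.action.ideal (s * t)).Mult)
      rw [star_star] at h1
      rw [← h1, ← h2]
      rfl)

theorem reverse_isReverse : E.reverse.IsReverse E :=
  ⟨(conj E.X).toLinearEquiv, fun _ _ => rfl, fun _ _ => rfl, fun _ _ => rfl, fun _ _ => rfl,
    fun _ x => ⟨E.conj_mem_reverse_idealMul_iff.2 x.2, rfl⟩⟩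

end TwistedMoritaEquivalence

end Symm

/-! ### The balanced tensor product -/

namespace ImprimitivityBimodule

variable {A B C X Y : Type u}
  [NonUnitalCStarAlgebra A] [PartialOrder A] [StarOrderedRing A]
  [NonUnitalCStarAlgebra B] [PartialOrder B] [StarOrderedRing B]
  [NonUnitalCStarAlgebra C] [PartialOrder C] [StarOrderedRing C]
  [NormedAddCommGroup X] [NormedSpace ℂ X] [CompleteSpace X]
  [NormedAddCommGroup Y] [NormedSpace ℂ Y] [CompleteSpace Y]
  (M : ImprimitivityBimodule A B X) (N : ImprimitivityBimodule B C Y)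

/-- The operators attached to `x ⊗ y`: the conjugate-linear map `w ↦ x · _B⟨y, w⟩` from `Y` to `X`
and its adjoint `x' ↦ ⟨x', x⟩_B · y`. -/
noncomputable def tensorPair :
    X →ₗ[ℂ] Y →ₗ[ℂ] (Y →L⋆[ℂ] X) × (X →L⋆[ℂ] Y) :=
  LinearMap.mk₂ ℂ
    (fun x y => ((M.rsmulL x).comp (N.linnerL y), (N.lsmulL.flip y).comp (M.rinnerL.flip x)))
    (fun x x' y => by ext <;> simp)
    (fun c x y => by ext <;> simp)
    (fun x y y' => by ext <;> simp)
    (fun c x y => by ext <;> simp)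

/-- The balanced tensor product `X ⊗_B Y`, realized as the compact operators from the reverse of
`Y` to `X`: the closed span of the pairs attached to the elementary tensors. Recording the adjoint
with each operator makes the existence of adjoints a closed condition. -/
noncomputable def tensorSubmodule : Submodule ℂ ((Y →L⋆[ℂ] X) × (X →L⋆[ℂ] Y)) :=
  (Submodule.span ℂ {z | ∃ x y, z = tensorPair M N x y}).topologicalClosure

/-- The balanced tensor product as a type. -/
def TensorSpace : Type u := tensorSubmodule M N

noncomputable instance : NormedAddCommGroup (TensorSpace M N) :=
  inferInstanceAs (NormedAddCommGroup (tensorSubmodule M N))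

noncomputable instance : NormedSpace ℂ (TensorSpace M N) :=
  inferInstanceAs (NormedSpace ℂ (tensorSubmodule M N))

theorem isClosed_tensorSubmodule :
    IsClosed (tensorSubmodule M N : Set ((Y →L⋆[ℂ] X) × (X →L⋆[ℂ] Y))) :=
  Submodule.isClosed_topologicalClosure _

instance : CompleteSpace (TensorSpace M N) :=
  haveI : CompleteSpace (tensorSubmodule M N) :=
    (isClosed_tensorSubmodule M N).completeSpace_coe
  inferInstanceAs (CompleteSpace (tensorSubmodule M N))

variable {M N} in
/-- An element of the tensor product as an operator from `Y` to `X`. -/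
def TensorSpace.op (z : TensorSpace M N) : Y →L⋆[ℂ] X := (show tensorSubmodule M N from z).1.1

variable {M N} in
/-- The adjoint of an element of the tensor product. -/
def TensorSpace.adj (z : TensorSpace M N) : X →L⋆[ℂ] Y := (show tensorSubmodule M N from z).1.2

variable {M N} in
/-- An element of the tensor product from a pair of operators. -/
def TensorSpace.mk (p : (Y →L⋆[ℂ] X) × (X →L⋆[ℂ] Y)) (h : p ∈ tensorSubmodule M N) :
    TensorSpace M N := (⟨p, h⟩ : tensorSubmodule M N)

namespace TensorSpace

variable {M N}

@[simp] theorem op_mk (p : (Y →L⋆[ℂ] X) × (X →L⋆[ℂ] Y)) (h : p ∈ tensorSubmodule M N) :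
    (mk p h).op = p.1 := rfl
@[simp] theorem adj_mk (p : (Y →L⋆[ℂ] X) × (X →L⋆[ℂ] Y)) (h : p ∈ tensorSubmodule M N) :
    (mk p h).adj = p.2 := rfl
@[simp] theorem op_add (z z' : TensorSpace M N) : (z + z').op = z.op + z'.op := rfl
@[simp] theorem adj_add (z z' : TensorSpace M N) : (z + z').adj = z.adj + z'.adj := rfl
@[simp] theorem op_smul (c : ℂ) (z : TensorSpace M N) : (c • z).op = c • z.op := rfl
@[simp] theorem adj_smul (c : ℂ) (z : TensorSpace M N) : (c • z).adj = c • z.adj := rfl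

theorem ext {z z' : TensorSpace M N} (h1 : ∀ w, z.op w = z'.op w)
    (h2 : ∀ x, z.adj x = z'.adj x) : z = z' :=
  Subtype.ext (Prod.ext (ContinuousLinearMap.ext h1) (ContinuousLinearMap.ext h2))

end TensorSpace

theorem tensorPair_mem (x : X) (y : Y) : tensorPair M N x y ∈ tensorSubmodule M N :=
  Submodule.le_topologicalClosure _ (Submodule.subset_span ⟨x, y, rfl⟩)

variable {M N}

theorem tensorSubmodule_le {L : Submodule ℂ ((Y →L⋆[ℂ] X) × (X →L⋆[ℂ] Y))}
    (hL : IsClosed (L : Set ((Y →L⋆[ℂ] X) × (X →L⋆[ℂ] Y))))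
    (h : ∀ x y, tensorPair M N x y ∈ L) : tensorSubmodule M N ≤ L := by
  refine Submodule.topologicalClosure_span_le hL ?_
  rintro _ ⟨x, y, rfl⟩
  exact h x y

/-- The two components of an element of the tensor product are adjoint to each other. -/
theorem rinner_op (z : TensorSpace M N) (x : X) (w : Y) :
    M.rinner x (z.op w) = N.linner (z.adj x) w := by
  let L : ((Y →L⋆[ℂ] X) × (X →L⋆[ℂ] Y)) →ₗ[ℂ] B :=
    { toFun := fun z => M.rinnerL x (z.1 w) - N.linnerL (z.2 x) w
      map_add' := fun z z' => by simp; abel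
      map_smul' := fun c z => by simp [smul_sub] }
  have hL : Continuous L := by
    change Continuous fun z : (Y →L⋆[ℂ] X) × (X →L⋆[ℂ] Y) =>
      M.rinnerL x (z.1 w) - N.linnerL (z.2 x) w
    have h1 : Continuous fun z : (Y →L⋆[ℂ] X) × (X →L⋆[ℂ] Y) => N.linnerL.flip w (z.2 x) := by
      fun_prop
    have h2 : Continuous fun z : (Y →L⋆[ℂ] X) × (X →L⋆[ℂ] Y) => M.rinnerL x (z.1 w) := by
      fun_prop
    exact h2.sub h1
  have := tensorSubmodule_le (M := M) (N := N) (L := LinearMap.ker L)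
    (isClosed_singleton.preimage hL) (fun x' y => by
      change M.rinner x (M.rsmul x' (N.linner y w)) -
        N.linner (N.lsmul (M.rinner x x') y) w = 0
      rw [M.rinner_rsmul, N.linner_lsmul, sub_self]) z.2
  exact sub_eq_zero.1 this

theorem rinner_op_left (z : TensorSpace M N) (x : X) (w : Y) :
    M.rinner (z.op w) x = N.linner w (z.adj x) := by
  rw [← M.star_rinner, rinner_op, N.star_linner]

theorem lsmul_mem_tensorSubmodule (a : A) (z : TensorSpace M N) :
    ((M.lsmulL a).comp z.op, z.adj.comp (M.lsmulL (star a))) ∈ tensorSubmodule M N := by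
  let L : ((Y →L⋆[ℂ] X) × (X →L⋆[ℂ] Y)) →ₗ[ℂ] ((Y →L⋆[ℂ] X) × (X →L⋆[ℂ] Y)) :=
    { toFun := fun z => ((M.lsmulL a).comp z.1, z.2.comp (M.lsmulL (star a)))
      map_add' := fun z z' => by ext <;> simp
      map_smul' := fun c z => by ext <;> simp }
  have hL : Continuous L := by
    change Continuous fun z : (Y →L⋆[ℂ] X) × (X →L⋆[ℂ] Y) =>
      ((M.lsmulL a).comp z.1, z.2.comp (M.lsmulL (star a)))
    exact ((ContinuousLinearMap.compSL Y X X (starRingEnd ℂ) (RingHom.id ℂ)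
      (M.lsmulL a)).continuous.comp continuous_fst).prodMk
        (((ContinuousLinearMap.compSL X X Y (RingHom.id ℂ) (starRingEnd ℂ)).flip
          (M.lsmulL (star a))).continuous.comp continuous_snd)
  refine tensorSubmodule_le (L := (tensorSubmodule M N).comap L)
    ((isClosed_tensorSubmodule M N).preimage hL) (fun x y => ?_) z.2
  suffices key : L (tensorPair M N x y) = tensorPair M N (M.lsmul a x) y by
    rw [Submodule.mem_comap, key]
    exact tensorPair_mem M N _ y
  refine Prod.ext (ContinuousLinearMap.ext fun w => ?_) (ContinuousLinearMap.ext fun x' => ?_)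
  · exact M.lsmul_rsmul _ _ _
  · change N.lsmul (M.rinner (M.lsmul (star a) x') x) y = N.lsmul (M.rinner x' (M.lsmul a x)) y
    rw [M.rinner_lsmul]

theorem rsmul_mem_tensorSubmodule (z : TensorSpace M N) (c : C) :
    (z.op.comp (N.rsmulL.flip (star c)), (N.rsmulL.flip c).comp z.adj) ∈
      tensorSubmodule M N := by
  let L : ((Y →L⋆[ℂ] X) × (X →L⋆[ℂ] Y)) →ₗ[ℂ] ((Y →L⋆[ℂ] X) × (X →L⋆[ℂ] Y)) :=
    { toFun := fun z => (z.1.comp (N.rsmulL.flip (star c)), (N.rsmulL.flip c).comp z.2)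
      map_add' := fun z z' => by ext <;> simp
      map_smul' := fun c z => by ext <;> simp }
  have hL : Continuous L := by
    change Continuous fun z : (Y →L⋆[ℂ] X) × (X →L⋆[ℂ] Y) =>
      (z.1.comp (N.rsmulL.flip (star c)), (N.rsmulL.flip c).comp z.2)
    exact (((ContinuousLinearMap.compSL Y Y X (RingHom.id ℂ) (starRingEnd ℂ)).flip
      (N.rsmulL.flip (star c))).continuous.comp continuous_fst).prodMk
        ((ContinuousLinearMap.compSL X Y Y (starRingEnd ℂ) (RingHom.id ℂ)
          (N.rsmulL.flip c)).continuous.comp continuous_snd)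
  refine tensorSubmodule_le (L := (tensorSubmodule M N).comap L)
    ((isClosed_tensorSubmodule M N).preimage hL) (fun x y => ?_) z.2
  suffices key : L (tensorPair M N x y) = tensorPair M N x (N.rsmul y c) by
    rw [Submodule.mem_comap, key]
    exact tensorPair_mem M N x _
  refine Prod.ext (ContinuousLinearMap.ext fun w => ?_) (ContinuousLinearMap.ext fun x' => ?_)
  · change M.rsmul x (N.linner y (N.rsmul w (star c))) = M.rsmul x (N.linner (N.rsmul y c) w)
    rw [N.linner_rsmul]
  · exact (N.lsmul_rsmul _ _ _).symm

/-- The left inner product: `_A⟨z₁, z₂⟩` acts as the composite of `z₁` and the adjoint of `z₂`. -/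
theorem exists_tensor_linner (z₁ z₂ : TensorSpace M N) :
    ∃ a : A, ∀ x, M.lsmul a x = z₁.op (z₂.adj x) := by
  let R : Submodule ℂ (X →L[ℂ] X) := LinearMap.range M.lsmulIsometry.toLinearMap
  have hR : IsClosed (R : Set (X →L[ℂ] X)) := by
    have := M.lsmulIsometry.isometry.isClosedEmbedding.isClosed_range
    rwa [← LinearIsometry.coe_toLinearMap, ← LinearMap.coe_range] at this
  let compL := ContinuousLinearMap.compSL X Y X (starRingEnd ℂ) (starRingEnd ℂ)
  have h1 : ∀ x y, ∀ z₁ ∈ tensorSubmodule M N, compL z₁.1 (tensorPair M N x y).2 ∈ R := by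
    intro x y z₁ hz₁
    let L := (compL.flip (tensorPair M N x y).2).comp
      (ContinuousLinearMap.fst ℂ (Y →L⋆[ℂ] X) (X →L⋆[ℂ] Y))
    refine tensorSubmodule_le (L := R.comap L.toLinearMap) (hR.preimage L.continuous)
      (fun x' y' => ⟨M.linner (M.rsmul x' (N.linner y' y)) x, ?_⟩) hz₁
    refine ContinuousLinearMap.ext fun v => ?_
    change M.lsmul (M.linner (M.rsmul x' (N.linner y' y)) x) v =
      M.rsmul x' (N.linner y' (N.lsmul (M.rinner v x) y))
    rw [M.linner_lsmul_eq, ← M.rsmul_mul, N.linner_lsmul_right, M.star_rinner]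
  let L := (compL z₁.op).comp (ContinuousLinearMap.snd ℂ (Y →L⋆[ℂ] X) (X →L⋆[ℂ] Y))
  obtain ⟨a, ha⟩ := tensorSubmodule_le (M := M) (N := N) (L := R.comap L.toLinearMap)
    (hR.preimage L.continuous) (fun x y => h1 x y z₁.1 z₁.2) z₂.2
  exact ⟨a, fun x => congrArg (fun T : X →L[ℂ] X => T x) ha⟩

/-- The right inner product: `⟨z₁, z₂⟩_C` acts as the composite of the adjoint of `z₂` and `z₁`. -/
theorem exists_tensor_rinner (z₁ z₂ : TensorSpace M N) :
    ∃ c : C, ∀ w, N.rsmul w c = z₂.adj (z₁.op w) := by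
  let R : Submodule ℂ (Y →L[ℂ] Y) := LinearMap.range N.rsmulIsometry.toLinearMap
  have hR : IsClosed (R : Set (Y →L[ℂ] Y)) := by
    have := N.rsmulIsometry.isometry.isClosedEmbedding.isClosed_range
    rwa [← LinearIsometry.coe_toLinearMap, ← LinearMap.coe_range] at this
  let compL := ContinuousLinearMap.compSL Y X Y (starRingEnd ℂ) (starRingEnd ℂ)
  have h1 : ∀ x y, ∀ z₂ ∈ tensorSubmodule M N, compL z₂.2 (tensorPair M N x y).1 ∈ R := by
    intro x y z₂ hz₂
    let L := (compL.flip (tensorPair M N x y).1).comp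
      (ContinuousLinearMap.snd ℂ (Y →L⋆[ℂ] X) (X →L⋆[ℂ] Y))
    refine tensorSubmodule_le (L := R.comap L.toLinearMap) (hR.preimage L.continuous)
      (fun x' y' => ⟨N.rinner y (N.lsmul (M.rinner x x') y'), ?_⟩) hz₂
    refine ContinuousLinearMap.ext fun v => ?_
    change N.rsmul v (N.rinner y (N.lsmul (M.rinner x x') y')) =
      N.lsmul (M.rinner (M.rsmul x (N.linner y v)) x') y'
    rw [← N.linner_lsmul_eq, ← N.lsmul_mul, M.rinner_rsmul_left, N.star_linner]
  let L := (compL z₂.adj).comp (ContinuousLinearMap.fst ℂ (Y →L⋆[ℂ] X) (X →L⋆[ℂ] Y))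
  obtain ⟨c, hc⟩ := tensorSubmodule_le (M := M) (N := N) (L := R.comap L.toLinearMap)
    (hR.preimage L.continuous) (fun x y => h1 x y z₂.1 z₂.2) z₁.2
  exact ⟨c, fun w => congrArg (fun T : Y →L[ℂ] Y => T w) hc⟩

/-- The `A`-valued inner product of the tensor product. -/
noncomputable def tensorLinner (z₁ z₂ : TensorSpace M N) : A := (exists_tensor_linner z₁ z₂).choose

/-- The `C`-valued inner product of the tensor product. -/
noncomputable def tensorRinner (z₁ z₂ : TensorSpace M N) : C := (exists_tensor_rinner z₁ z₂).choose

theorem lsmul_tensorLinner (z₁ z₂ : TensorSpace M N) (x : X) :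
    M.lsmul (tensorLinner z₁ z₂) x = z₁.op (z₂.adj x) :=
  (exists_tensor_linner z₁ z₂).choose_spec x

theorem rsmul_tensorRinner (z₁ z₂ : TensorSpace M N) (w : Y) :
    N.rsmul w (tensorRinner z₁ z₂) = z₂.adj (z₁.op w) :=
  (exists_tensor_rinner z₁ z₂).choose_spec w

theorem norm_op_sq_le (z : TensorSpace M N) : ‖z.op‖ ^ 2 ≤ ‖tensorRinner z z‖ := by
  have h : ‖z.op‖ ≤ √‖tensorRinner z z‖ := by
    refine ContinuousLinearMap.opNorm_le_bound _ (Real.sqrt_nonneg _) fun w => ?_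
    refine le_of_sq_le_sq ?_ (by positivity)
    rw [mul_pow, Real.sq_sqrt (norm_nonneg _), M.norm_sq_eq_rinner, rinner_op,
      ← rsmul_tensorRinner]
    calc _ ≤ ‖N.rsmul w (tensorRinner z z)‖ * ‖w‖ := N.norm_linner_le _ _
      _ ≤ ‖w‖ * ‖tensorRinner z z‖ * ‖w‖ := by gcongr; exact N.norm_rsmul_le _ _
      _ = _ := by ring
  calc _ ≤ √‖tensorRinner z z‖ ^ 2 := by gcongr
    _ = _ := Real.sq_sqrt (norm_nonneg _)

theorem norm_adj_sq_le (z : TensorSpace M N) : ‖z.adj‖ ^ 2 ≤ ‖tensorLinner z z‖ := by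
  have h : ‖z.adj‖ ≤ √‖tensorLinner z z‖ := by
    refine ContinuousLinearMap.opNorm_le_bound _ (Real.sqrt_nonneg _) fun x => ?_
    refine le_of_sq_le_sq ?_ (by positivity)
    rw [mul_pow, Real.sq_sqrt (norm_nonneg _), N.norm_sq_eq_linner, ← rinner_op,
      ← lsmul_tensorLinner]
    calc _ ≤ ‖x‖ * ‖M.lsmul (tensorLinner z z) x‖ := M.norm_rinner_le _ _
      _ ≤ ‖x‖ * (‖tensorLinner z z‖ * ‖x‖) := by gcongr; exact M.norm_lsmul_le _ _
      _ = _ := by ring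
  calc _ ≤ √‖tensorLinner z z‖ ^ 2 := by gcongr
    _ = _ := Real.sq_sqrt (norm_nonneg _)

theorem norm_tensorRinner_le (z : TensorSpace M N) : ‖tensorRinner z z‖ ≤ ‖z.op‖ * ‖z.adj‖ := by
  rw [← N.rsmulIsometry.norm_map]
  refine ContinuousLinearMap.opNorm_le_bound _ (by positivity) fun w => ?_
  rw [rsmulIsometry_apply, rsmul_tensorRinner]
  calc _ ≤ ‖z.adj‖ * ‖z.op w‖ := z.adj.le_opNorm _
    _ ≤ ‖z.adj‖ * (‖z.op‖ * ‖w‖) := by gcongr; exact z.op.le_opNorm _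
    _ = _ := by ring

theorem norm_tensorLinner_le (z : TensorSpace M N) : ‖tensorLinner z z‖ ≤ ‖z.op‖ * ‖z.adj‖ := by
  rw [← M.lsmulIsometry.norm_map]
  refine ContinuousLinearMap.opNorm_le_bound _ (by positivity) fun x => ?_
  rw [lsmulIsometry_apply, lsmul_tensorLinner]
  calc _ ≤ ‖z.op‖ * ‖z.adj x‖ := z.op.le_opNorm _
    _ ≤ ‖z.op‖ * (‖z.adj‖ * ‖x‖) := by gcongr; exact z.adj.le_opNorm _
    _ = _ := by ring

theorem norm_op_eq_norm_adj (z : TensorSpace M N) : ‖z.op‖ = ‖z.adj‖ := by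
  have h1 := (norm_op_sq_le z).trans (norm_tensorRinner_le z)
  have h2 := (norm_adj_sq_le z).trans (norm_tensorLinner_le z)
  nlinarith [norm_nonneg z.op, norm_nonneg z.adj]

theorem norm_eq_norm_op (z : TensorSpace M N) : ‖z‖ = ‖z.op‖ := by
  change max ‖z.op‖ ‖z.adj‖ = _
  rw [← norm_op_eq_norm_adj, max_self]

theorem norm_sq_eq_tensorRinner (z : TensorSpace M N) : ‖z‖ ^ 2 = ‖tensorRinner z z‖ := by
  rw [norm_eq_norm_op]
  refine le_antisymm (norm_op_sq_le z) ((norm_tensorRinner_le z).trans_eq ?_)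
  rw [← norm_op_eq_norm_adj, sq]

theorem norm_sq_eq_tensorLinner (z : TensorSpace M N) : ‖z‖ ^ 2 = ‖tensorLinner z z‖ := by
  rw [norm_eq_norm_op, norm_op_eq_norm_adj]
  refine le_antisymm (norm_adj_sq_le z) ((norm_tensorLinner_le z).trans_eq ?_)
  rw [norm_op_eq_norm_adj, sq]

theorem star_tensorRinner (z₁ z₂ : TensorSpace M N) :
    star (tensorRinner z₁ z₂) = tensorRinner z₂ z₁ := by
  refine N.eq_of_forall_rsmul fun w => ?_
  have h : ∀ w', N.linner w' (N.rsmul w (star (tensorRinner z₁ z₂))) =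
      N.linner w' (N.rsmul w (tensorRinner z₂ z₁)) := fun w' => by
    rw [← N.linner_rsmul, rsmul_tensorRinner, rsmul_tensorRinner, ← rinner_op,
      ← rinner_op_left]
  have h0 : N.rsmul w (star (tensorRinner z₁ z₂)) - N.rsmul w (tensorRinner z₂ z₁) = 0 := by
    rw [← norm_eq_zero, ← sq_eq_zero_iff, N.norm_sq_eq_linner, ← N.linnerL_apply]
    nth_rewrite 2 [sub_eq_add_neg]
    rw [map_add, map_neg, N.linnerL_apply, N.linnerL_apply, h, add_neg_cancel, norm_zero]
  exact sub_eq_zero.1 h0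

theorem star_tensorLinner (z₁ z₂ : TensorSpace M N) :
    star (tensorLinner z₁ z₂) = tensorLinner z₂ z₁ := by
  refine M.eq_of_forall_lsmul fun x => ?_
  have h : ∀ x', M.rinner x' (M.lsmul (star (tensorLinner z₁ z₂)) x) =
      M.rinner x' (M.lsmul (tensorLinner z₂ z₁) x) := fun x' => by
    rw [M.rinner_lsmul, star_star, lsmul_tensorLinner, lsmul_tensorLinner, rinner_op,
      rinner_op_left]
  have h0 : M.lsmul (star (tensorLinner z₁ z₂)) x - M.lsmul (tensorLinner z₂ z₁) x = 0 := by
    rw [← norm_eq_zero, ← sq_eq_zero_iff, M.norm_sq_eq_rinner, ← M.rinnerL_apply]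
    nth_rewrite 2 [sub_eq_add_neg]
    rw [map_add, map_neg, M.rinnerL_apply, M.rinnerL_apply, h, add_neg_cancel, norm_zero]
  exact sub_eq_zero.1 h0

variable (M N) in
/-- The balanced tensor product as a Hilbert bimodule. -/
noncomputable def tensorHilbert : HilbertBimodule A C (TensorSpace M N) where
  lsmul := LinearMap.mk₂ ℂ (fun a z => TensorSpace.mk _ (lsmul_mem_tensorSubmodule a z))
    (fun a a' z => by apply TensorSpace.ext <;> intro <;> simp)
    (fun c a z => by apply TensorSpace.ext <;> intro <;> simp)
    (fun a z z' => by apply TensorSpace.ext <;> intro <;> simp)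
    (fun c a z => by apply TensorSpace.ext <;> intro <;> simp)
  rsmul := LinearMap.mk₂ ℂ (fun z c => TensorSpace.mk _ (rsmul_mem_tensorSubmodule z c))
    (fun z z' c => by apply TensorSpace.ext <;> intro <;> simp)
    (fun c z a => by apply TensorSpace.ext <;> intro <;> simp)
    (fun z c c' => by apply TensorSpace.ext <;> intro <;> simp)
    (fun c z a => by apply TensorSpace.ext <;> intro <;> simp)
  linner := tensorLinner
  rinner := tensorRinner
  lsmul_mul a a' z := by
    apply TensorSpace.ext <;> intro <;> simp [HilbertBimodule.lsmulL_apply, M.lsmul_mul]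
  rsmul_mul z c c' := by
    apply TensorSpace.ext <;> intro <;> simp [HilbertBimodule.rsmulL_apply, N.rsmul_mul]
  lsmul_rsmul a z c := by apply TensorSpace.ext <;> intro <;> simp
  rinner_linear c d z z₁ z₂ := N.eq_of_forall_rsmul fun w => by
    simp [rsmul_tensorRinner]
  rinner_rsmul z₁ z₂ c := N.eq_of_forall_rsmul fun w => by
    rw [N.rsmul_mul, rsmul_tensorRinner, rsmul_tensorRinner]
    rfl
  star_rinner := star_tensorRinner
  rinner_self_nonneg z := by
    have h : IsSelfAdjoint (tensorRinner z z) := star_tensorRinner z z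
    refine N.reverse.nonneg_of_forall_linner_lsmul h fun w => ?_
    change 0 ≤ N.linner ((ConjSpace.conj Y).symm w)
      (N.rsmul ((ConjSpace.conj Y).symm w) (star (tensorRinner z z)))
    rw [h.star_eq, rsmul_tensorRinner, ← rinner_op_left]
    exact M.rinner_self_nonneg _
  norm_sq_eq_rinner := norm_sq_eq_tensorRinner
  linner_linear c d z₁ z₂ z := M.eq_of_forall_lsmul fun x => by
    simp [lsmul_tensorLinner]
  linner_lsmul a z₁ z₂ := M.eq_of_forall_lsmul fun x => by
    rw [M.lsmul_mul, lsmul_tensorLinner, lsmul_tensorLinner]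
    rfl
  star_linner := star_tensorLinner
  linner_self_nonneg z := by
    refine M.nonneg_of_forall_linner_lsmul (star_tensorLinner z z) fun x => ?_
    rw [lsmul_tensorLinner, rinner_op]
    exact N.linner_self_nonneg _
  norm_sq_eq_linner := norm_sq_eq_tensorLinner
  linner_lsmul_eq z₁ z₂ z₃ := by
    apply TensorSpace.ext
    · intro w
      change M.lsmul (tensorLinner z₁ z₂) (z₃.op w) =
        z₁.op (N.rsmul w (star (tensorRinner z₂ z₃)))
      rw [lsmul_tensorLinner, star_tensorRinner, rsmul_tensorRinner]
    · intro x
      change z₃.adj (M.lsmul (star (tensorLinner z₁ z₂)) x) =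
        N.rsmul (z₁.adj x) (tensorRinner z₂ z₃)
      rw [rsmul_tensorRinner, star_tensorLinner, lsmul_tensorLinner]

/-! ### Elementary tensors -/

variable (M N) in
/-- The elementary tensors `x ⊗ y`. -/
noncomputable def tmul : X →ₗ[ℂ] Y →ₗ[ℂ] TensorSpace M N :=
  LinearMap.mk₂ ℂ (fun x y => TensorSpace.mk (tensorPair M N x y) (tensorPair_mem M N x y))
    (fun _ _ _ => Subtype.ext (LinearMap.map_add₂ _ _ _ _))
    (fun _ _ _ => Subtype.ext (LinearMap.map_smul₂ _ _ _ _))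
    (fun _ _ _ => Subtype.ext (LinearMap.map_add _ _ _))
    (fun _ _ _ => Subtype.ext (LinearMap.map_smul _ _ _))

theorem tmul_rsmul (x : X) (b : B) (y : Y) :
    tmul M N (M.rsmul x b) y = tmul M N x (N.lsmul b y) := by
  apply TensorSpace.ext
  · intro w
    change M.rsmul (M.rsmul x b) (N.linner y w) = M.rsmul x (N.linner (N.lsmul b y) w)
    rw [N.linner_lsmul, M.rsmul_mul]
  · intro x'
    change N.lsmul (M.rinner x' (M.rsmul x b)) y = N.lsmul (M.rinner x' x) (N.lsmul b y)
    rw [M.rinner_rsmul, N.lsmul_mul]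

theorem lsmul_tmul (a : A) (x : X) (y : Y) :
    (tensorHilbert M N).lsmul a (tmul M N x y) = tmul M N (M.lsmul a x) y := by
  apply TensorSpace.ext
  · intro w
    exact M.lsmul_rsmul _ _ _
  · intro x'
    change N.lsmul (M.rinner (M.lsmul (star a) x') x) y = N.lsmul (M.rinner x' (M.lsmul a x)) y
    rw [M.rinner_lsmul]

theorem rsmul_tmul (x : X) (y : Y) (c : C) :
    (tensorHilbert M N).rsmul (tmul M N x y) c = tmul M N x (N.rsmul y c) := by
  apply TensorSpace.ext
  · intro w
    change M.rsmul x (N.linner y (N.rsmul w (star c))) = M.rsmul x (N.linner (N.rsmul y c) w)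
    rw [N.linner_rsmul]
  · intro x'
    exact (N.lsmul_rsmul _ _ _).symm

theorem rinner_tmul (x₁ x₂ : X) (y₁ y₂ : Y) :
    (tensorHilbert M N).rinner (tmul M N x₁ y₁) (tmul M N x₂ y₂) =
      N.rinner y₁ (N.lsmul (M.rinner x₁ x₂) y₂) := by
  refine N.eq_of_forall_rsmul fun w => (rsmul_tensorRinner _ _ w).trans ?_
  change N.lsmul (M.rinner (M.rsmul x₁ (N.linner y₁ w)) x₂) y₂ = _
  rw [← N.linner_lsmul_eq, ← N.lsmul_mul, M.rinner_rsmul_left, N.star_linner]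

theorem linner_tmul (x₁ x₂ : X) (y₁ y₂ : Y) :
    (tensorHilbert M N).linner (tmul M N x₁ y₁) (tmul M N x₂ y₂) =
      M.linner (M.rsmul x₁ (N.linner y₁ y₂)) x₂ := by
  refine M.eq_of_forall_lsmul fun v => (lsmul_tensorLinner _ _ v).trans ?_
  change M.rsmul x₁ (N.linner y₁ (N.lsmul (M.rinner v x₂) y₂)) = _
  rw [M.linner_lsmul_eq, ← M.rsmul_mul, N.linner_lsmul_right, M.star_rinner]

theorem norm_tmul_le (x : X) (y : Y) : ‖tmul M N x y‖ ≤ 1 * ‖x‖ * ‖y‖ := by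
  refine le_of_sq_le_sq ?_ (by positivity)
  rw [(tensorHilbert M N).norm_sq_eq_rinner, rinner_tmul, one_mul]
  calc _ ≤ ‖y‖ * (‖M.rinner x x‖ * ‖y‖) :=
        (N.norm_rinner_le _ _).trans (by gcongr; exact N.norm_lsmul_le _ _)
    _ = _ := by rw [← M.norm_sq_eq_rinner]; ring

variable (M N) in
/-- The elementary tensors as a bounded bilinear map. -/
noncomputable def tmulL : X →L[ℂ] Y →L[ℂ] TensorSpace M N :=
  LinearMap.mkContinuous₂ (E := X) (F := Y) (G := TensorSpace M N) (σ₁₃ := RingHom.id ℂ)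
    (σ₂₃ := RingHom.id ℂ) (tmul M N) 1 norm_tmul_le

theorem tmul_induction {L : Submodule ℂ (TensorSpace M N)}
    (hL : IsClosed (L : Set (TensorSpace M N))) (h : ∀ x y, tmul M N x y ∈ L)
    (z : TensorSpace M N) : z ∈ L := by
  let L' : Submodule ℂ (tensorSubmodule M N) := L
  have h1 : IsClosed (L'.map (tensorSubmodule M N).subtype :
      Set ((Y →L⋆[ℂ] X) × (X →L⋆[ℂ] Y))) := by
    rw [Submodule.map_coe]
    exact (isClosed_tensorSubmodule M N).isClosedEmbedding_subtypeVal.isClosedMap _ hL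
  obtain ⟨z', hz', he⟩ := tensorSubmodule_le h1 (fun x y => ⟨_, h x y, rfl⟩) z.2
  exact Subtype.ext he ▸ hz'

theorem closure_span_tmul :
    closure (Submodule.span ℂ {z | ∃ x y, z = tmul M N x y} : Set (TensorSpace M N)) =
      Set.univ :=
  Set.eq_univ_of_forall fun z =>
    tmul_induction (L := (Submodule.span ℂ {z | ∃ x y, z = tmul M N x y}).topologicalClosure)
      (Submodule.isClosed_topologicalClosure _)
      (fun x y => Submodule.le_topologicalClosure _ (Submodule.subset_span ⟨x, y, rfl⟩)) z

variable (M N) in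
/-- The balanced tensor product of imprimitivity bimodules is an imprimitivity bimodule. -/
noncomputable def tensor : ImprimitivityBimodule A C (TensorSpace M N) where
  toHilbertBimodule := tensorHilbert M N
  full_left := by
    refine Set.eq_univ_of_forall fun a => ?_
    let L := (Submodule.span ℂ
      {a | ∃ z w, a = (tensorHilbert M N).linner z w}).topologicalClosure
    have hL : IsClosed (L : Set A) := Submodule.isClosed_topologicalClosure _
    refine M.linner_induction (N := L) hL (fun x x' => ?_) a
    have hx : ∀ x₁ (b : B), M.linner (M.rsmul x₁ b) x' ∈ L := fun x₁ => by
      let T := (M.linnerL.flip x').comp (M.rsmulL x₁)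
      refine N.linner_induction (N := L.comap (T : B →ₗ[ℂ] A)) (hL.preimage T.continuous)
        fun y y' => Submodule.le_topologicalClosure _ (Submodule.subset_span
          ⟨tmul M N x₁ y, tmul M N x' y', (linner_tmul _ _ _ _).symm⟩)
    let T : X →L[ℂ] A := M.linnerL.flip x'
    exact M.mulIdeal_le (N := L.comap (T : X →ₗ[ℂ] A)) (hL.preimage T.continuous)
      (fun x₁ b _ => hx x₁ b) (M.mulIdeal_whole x)
  full_right := by
    refine Set.eq_univ_of_forall fun c => ?_
    let L := (Submodule.span ℂ
      {c | ∃ z w, c = (tensorHilbert M N).rinner z w}).topologicalClosure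
    have hL : IsClosed (L : Set C) := Submodule.isClosed_topologicalClosure _
    refine N.rinner_induction (N := L) hL (fun y y' => ?_) c
    have hy : ∀ (b : B) y₁, N.rinner y (N.lsmul b y₁) ∈ L := fun b y₁ => by
      let T := (N.rinnerL y).comp (N.lsmulL.flip y₁)
      refine M.rinner_induction (N := L.comap (T : B →ₗ[ℂ] C)) (hL.preimage T.continuous)
        (fun x x' => Submodule.le_topologicalClosure _ (Submodule.subset_span
          ⟨tmul M N x y, tmul M N x' y₁, (rinner_tmul _ _ _ _).symm⟩)) b
    exact N.idealMul_le (N := L.comap (N.rinnerL y : Y →ₗ[ℂ] C))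
      (hL.preimage (N.rinnerL y).continuous) (fun b _ y₁ => hy b y₁) (N.idealMul_whole y')

end ImprimitivityBimodule

/-! ### Graphs of isomorphisms of ideals -/

namespace ClosedIdeal

variable {A : Type u} [NonUnitalCStarAlgebra A] {I I' : ClosedIdeal A}

/-- The graph of an isomorphism between two ideals, as a relation on the ambient algebra. -/
def isoGraph (γ : I.Elem ≃⋆ₐ[ℂ] I'.Elem) : Submodule ℂ (A × A) where
  carrier := Set.range fun a : I.Elem => ((a : A), (γ a : A))
  add_mem' := by
    rintro _ _ ⟨a, rfl⟩ ⟨b, rfl⟩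
    exact ⟨a + b, by simp⟩
  zero_mem' := ⟨0, by simp⟩
  smul_mem' := by
    rintro c _ ⟨a, rfl⟩
    exact ⟨c • a, by simp⟩

theorem mk_mem_isoGraph {γ : I.Elem ≃⋆ₐ[ℂ] I'.Elem} {a : I.Elem} {a' : A} :
    ((a : A), a') ∈ isoGraph γ ↔ (γ a : A) = a' := by
  constructor
  · rintro ⟨b, hb⟩
    rw [Prod.mk.injEq] at hb
    rw [← Subtype.ext hb.1, hb.2]
  · rintro rfl
    exact ⟨a, rfl⟩

theorem isClosed_isoGraph (γ : I.Elem ≃⋆ₐ[ℂ] I'.Elem) : IsClosed (isoGraph γ : Set (A × A)) := by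
  have : CompleteSpace I.Elem := I.isClosed.completeSpace_coe
  have h : Isometry fun a : I.Elem => ((a : A), (γ a : A)) := Isometry.of_dist_eq fun a b => by
    have h1 : dist (γ a) (γ b) = dist a b := by
      rw [dist_eq_norm, dist_eq_norm, ← map_sub, StarAlgEquiv.norm_map]
    change max (dist a b) (dist (γ a) (γ b)) = _
    rw [h1, max_self]
  exact h.isClosedEmbedding.isClosed_range

theorem star_mem_isoGraph (γ : I.Elem ≃⋆ₐ[ℂ] I'.Elem) :
    ∀ p ∈ isoGraph γ, star p ∈ isoGraph γ := by
  rintro _ ⟨a, rfl⟩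
  exact ⟨star a, by simp [map_star]; rfl⟩

theorem norm_eq_of_mem_isoGraph {γ : I.Elem ≃⋆ₐ[ℂ] I'.Elem} {p : A × A} (h : p ∈ isoGraph γ) :
    ‖p.2‖ = ‖p.1‖ := by
  obtain ⟨a, rfl⟩ := h
  exact StarAlgEquiv.norm_map γ a

end ClosedIdeal

/-! ### Ideals and multipliers in a tensor product -/

namespace ImprimitivityBimodule

variable {A B C X Y : Type u}
  [NonUnitalCStarAlgebra A] [PartialOrder A] [StarOrderedRing A]
  [NonUnitalCStarAlgebra B] [PartialOrder B] [StarOrderedRing B]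
  [NonUnitalCStarAlgebra C] [PartialOrder C] [StarOrderedRing C]
  [NormedAddCommGroup X] [NormedSpace ℂ X] [CompleteSpace X]
  [NormedAddCommGroup Y] [NormedSpace ℂ Y] [CompleteSpace Y]
  {M : ImprimitivityBimodule A B X} {N : ImprimitivityBimodule B C Y}
  {I : ClosedIdeal A} {J : ClosedIdeal B} {K : ClosedIdeal C}

/-- `I · (X ⊗ Y)` is spanned by the tensors of elements of `I · X` and of `J · Y`, provided that
`I · X = X · J`. -/
theorem tensor_idealMul_eq_closure_span (hM : M.idealMul I = M.mulIdeal J) :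
    (tensor M N).idealMul I = (Submodule.span ℂ
      {z | ∃ x ∈ M.idealMul I, ∃ y ∈ N.idealMul J, z = tmul M N x y}).topologicalClosure := by
  set D := (Submodule.span ℂ
      {z | ∃ x ∈ M.idealMul I, ∃ y ∈ N.idealMul J, z = tmul M N x y}).topologicalClosure with hD
  have hDc : IsClosed (D : Set (TensorSpace M N)) := Submodule.isClosed_topologicalClosure _
  refine le_antisymm ?_ ?_
  · -- `x b ⊗ y` is the limit of `x e ⊗ b y`, with `e` running through an approximate unit of `J`
    have h1 : ∀ x ∈ M.mulIdeal J, ∀ y, tmul M N x y ∈ D := fun x hx y => by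
      refine M.mulIdeal_le (N := D.comap ((tmulL M N).flip y).toLinearMap)
        (hDc.preimage ((tmulL M N).flip y).continuous) (fun x b hb => ?_) hx
      obtain ⟨l, hl, hmem, -, h, -⟩ := J.exists_approximateUnit
      have ht := ((((tmulL M N).flip y).comp (M.rsmulL x)).continuous.tendsto b).comp (h b hb)
      refine hDc.mem_of_tendsto ht ?_
      filter_upwards [hmem] with e he
      change tmul M N (M.rsmul x (e * b)) y ∈ D
      rw [M.rsmul_mul, tmul_rsmul]
      exact Submodule.le_topologicalClosure _ (Submodule.subset_span
        ⟨_, hM ▸ M.rsmul_mem_mulIdeal x he, _, N.lsmul_mem_idealMul hb y, rfl⟩)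
    refine (tensor M N).idealMul_le hDc fun a ha z => ?_
    refine tmul_induction (L := D.comap ((tensor M N).lsmulL a).toLinearMap)
      (hDc.preimage ((tensor M N).lsmulL a).continuous) (fun x y => ?_) z
    change (tensorHilbert M N).lsmul a (tmul M N x y) ∈ D
    rw [lsmul_tmul]
    exact h1 _ (hM ▸ M.lsmul_mem_idealMul ha x) y
  · refine Submodule.topologicalClosure_span_le (tensor M N).isClosed_idealMul ?_
    rintro _ ⟨x, hx, y, -, rfl⟩
    refine M.idealMul_le (N := ((tensor M N).idealMul I).comap ((tmulL M N).flip y).toLinearMap)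
      ((tensor M N).isClosed_idealMul.preimage ((tmulL M N).flip y).continuous)
      (fun a ha x => ?_) hx
    change tmul M N (M.lsmul a x) y ∈ (tensor M N).idealMul I
    rw [← lsmul_tmul]
    exact (tensor M N).lsmul_mem_idealMul ha _

theorem tensor_mulIdeal_eq_closure_span (hM : M.idealMul I = M.mulIdeal J)
    (hN : N.idealMul J = N.mulIdeal K) :
    (tensor M N).mulIdeal K = (Submodule.span ℂ
      {z | ∃ x ∈ M.idealMul I, ∃ y ∈ N.idealMul J, z = tmul M N x y}).topologicalClosure := by
  set D := (Submodule.span ℂ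
      {z | ∃ x ∈ M.idealMul I, ∃ y ∈ N.idealMul J, z = tmul M N x y}).topologicalClosure with hD
  have hDc : IsClosed (D : Set (TensorSpace M N)) := Submodule.isClosed_topologicalClosure _
  refine le_antisymm ?_ ?_
  · -- `x ⊗ b y` is the limit of `x b ⊗ e y`, with `e` running through an approximate unit of `J`
    have h1 : ∀ x, ∀ y ∈ N.idealMul J, tmul M N x y ∈ D := fun x y hy => by
      refine N.idealMul_le (N := D.comap (tmulL M N x).toLinearMap)
        (hDc.preimage (tmulL M N x).continuous) (fun b hb y => ?_) hy
      obtain ⟨l, hl, hmem, -, -, h⟩ := J.exists_approximateUnit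
      have ht := (((tmulL M N x).comp (N.lsmulL.flip y)).continuous.tendsto b).comp (h b hb)
      refine hDc.mem_of_tendsto ht ?_
      filter_upwards [hmem] with e he
      change tmul M N x (N.lsmul (b * e) y) ∈ D
      rw [N.lsmul_mul, ← tmul_rsmul]
      exact Submodule.le_topologicalClosure _ (Submodule.subset_span
        ⟨_, hM ▸ M.rsmul_mem_mulIdeal x hb, _, N.lsmul_mem_idealMul he y, rfl⟩)
    refine (tensor M N).mulIdeal_le hDc fun z c hc => ?_
    refine tmul_induction (L := D.comap ((tensor M N).rsmulL.flip c).toLinearMap)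
      (hDc.preimage ((tensor M N).rsmulL.flip c).continuous) (fun x y => ?_) z
    change (tensorHilbert M N).rsmul (tmul M N x y) c ∈ D
    rw [rsmul_tmul]
    exact h1 x _ (hN ▸ N.rsmul_mem_mulIdeal y hc)
  · refine Submodule.topologicalClosure_span_le (tensor M N).isClosed_mulIdeal ?_
    rintro _ ⟨x, -, y, hy, rfl⟩
    rw [hN] at hy
    refine N.mulIdeal_le (N := ((tensor M N).mulIdeal K).comap (tmulL M N x).toLinearMap)
      ((tensor M N).isClosed_mulIdeal.preimage (tmulL M N x).continuous)
      (fun y c hc => ?_) hy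
    change tmul M N x (N.rsmul y c) ∈ (tensor M N).mulIdeal K
    rw [← rsmul_tmul]
    exact (tensor M N).rsmul_mem_mulIdeal _ hc

/-- Unitary multipliers of the middle algebra are balanced: `(x · v*) ⊗ (v · y) = x ⊗ y`. -/
theorem tmul_eq_of_isMultiple {v : unitary J.Mult} {x x' : X} {y y' : Y}
    (hx : M.IsRightMultiple x (star (v : J.Mult)) x') (hy : N.IsLeftMultiple (v : J.Mult) y y') :
    tmul M N x' y' = tmul M N x y := by
  let L : Y × Y →L[ℂ] TensorSpace M N := (tmulL M N x').comp (ContinuousLinearMap.snd ℂ Y Y) -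
    (tmulL M N x).comp (ContinuousLinearMap.fst ℂ Y Y)
  have : (y, y') ∈ LinearMap.ker L.toLinearMap := by
    refine Submodule.topologicalClosure_span_le
      (isClosed_singleton.preimage L.continuous) ?_ hy.mem_closure_span
    rintro _ ⟨b, y₁, rfl⟩
    change tmul M N x' (N.lsmul (ClosedIdeal.mulLeft (v : J.Mult) b) y₁) -
      tmul M N x (N.lsmul b y₁) = 0
    rw [← tmul_rsmul, hx.2.2, ClosedIdeal.mulLeft_mulLeft, Unitary.coe_star_mul_self,
      ClosedIdeal.mulLeft_one, tmul_rsmul, sub_self]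
  exact sub_eq_zero.1 this

end ImprimitivityBimodule

/-! ### Transitivity -/

/-- An identity `L (g (f z)) = L' (h z)` between partial isometries `f`, `g`, `h` with closed linear
graphs, valid on a set `T`, is valid on the closed span of `T`. -/
theorem Submodule.exists_comp_of_mem_closure_span {V W : Type*}
    [NormedAddCommGroup V] [NormedSpace ℂ V] [CompleteSpace V]
    [NormedAddCommGroup W] [NormedSpace ℂ W]
    {f g h : Submodule ℂ (V × V)} (hf : IsClosed (f : Set (V × V)))
    (hg : IsClosed (g : Set (V × V))) (hh : IsClosed (h : Set (V × V)))
    (nf : ∀ p ∈ f, ‖p.2‖ = ‖p.1‖) (ng : ∀ p ∈ g, ‖p.2‖ = ‖p.1‖) (nh : ∀ p ∈ h, ‖p.2‖ = ‖p.1‖)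
    (L L' : V →L[ℂ] W) {T : Set V}
    (hT : ∀ z ∈ T, ∃ x y w, (z, x) ∈ f ∧ (x, y) ∈ g ∧ (z, w) ∈ h ∧ L y = L' w)
    {z : V} (hz : z ∈ (Submodule.span ℂ T).topologicalClosure) :
    ∃ x y w, (z, x) ∈ f ∧ (x, y) ∈ g ∧ (z, w) ∈ h ∧ L y = L' w := by
  let p₁ := ContinuousLinearMap.fst ℂ V (V × V × V)
  let q := ContinuousLinearMap.snd ℂ V (V × V × V)
  let p₂ := (ContinuousLinearMap.fst ℂ V (V × V)).comp q
  let p₃ := ((ContinuousLinearMap.fst ℂ V V).comp (ContinuousLinearMap.snd ℂ V (V × V))).comp q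
  let p₄ := ((ContinuousLinearMap.snd ℂ V V).comp (ContinuousLinearMap.snd ℂ V (V × V))).comp q
  let D := L.comp p₃ - L'.comp p₄
  -- the quadruples `(z, x, y, w)` subject to the four conditions
  let N : Submodule ℂ (V × V × V × V) := f.comap (p₁.prod p₂).toLinearMap ⊓
    (g.comap (p₂.prod p₃).toLinearMap ⊓ (h.comap (p₁.prod p₄).toLinearMap ⊓
      LinearMap.ker D.toLinearMap))
  have hN : IsClosed (N : Set (V × V × V × V)) :=
    (hf.preimage (p₁.prod p₂).continuous).inter ((hg.preimage (p₂.prod p₃).continuous).inter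
      ((hh.preimage (p₁.prod p₄).continuous).inter (isClosed_singleton.preimage D.continuous)))
  obtain ⟨⟨z, x, y, w⟩, hp, rfl⟩ := Submodule.exists_mem_topologicalClosure_of_isometric N
    (LinearMap.fst ℂ V (V × V × V)) (fun p hp => by
      rw [hN.submodule_topologicalClosure_eq] at hp
      obtain ⟨h1, h2, h3, -⟩ := hp
      have e2 : ‖p.2.1‖ = ‖p.1‖ := nf _ h1
      have e3 : ‖p.2.2.1‖ = ‖p.2.1‖ := ng _ h2
      have e4 : ‖p.2.2.2‖ = ‖p.1‖ := nh _ h3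
      rw [Prod.norm_def, Prod.norm_def, Prod.norm_def, e3, e2, e4, max_self, max_self, max_self]
      rfl)
    (Submodule.topologicalClosure_mono (Submodule.span_le.2 fun z hz => by
      obtain ⟨x, y, w, h1, h2, h3, h4⟩ := hT z hz
      exact ⟨(z, x, y, w), ⟨h1, h2, h3, sub_eq_zero.2 h4⟩, rfl⟩) hz)
  rw [hN.submodule_topologicalClosure_eq] at hp
  obtain ⟨h1, h2, h3, h4⟩ := hp
  exact ⟨x, y, w, h1, h2, h3, sub_eq_zero.1 h4⟩

namespace TwistedMoritaEquivalence

open ImprimitivityBimodule ClosedIdeal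

variable {S : Type v} [InverseMonoid S] {P Q R : TwistedSystem.{u, v} S}
  (E : TwistedMoritaEquivalence P Q) (F : TwistedMoritaEquivalence Q R)

/-- The balanced tensor product of the underlying spaces. -/
abbrev tensorX : Type u := TensorSpace E.bimodule F.bimodule

/-- The pairs `(x ⊗ y, φ_s(x) ⊗ ψ_s(y))`. -/
def tensorPairs (s : S) :
    Set (E.tensorX F × E.tensorX F) :=
  {p | ∃ (x : E.bimodule.idealMul (P.action.ideal s⁻¹))
    (y : F.bimodule.idealMul (Q.action.ideal s⁻¹)),
    p = (tmul E.bimodule F.bimodule x y, tmul E.bimodule F.bimodule (E.map s x) (F.map s y))}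

/-- The closed span of the pairs `(x ⊗ y, φ_s(x) ⊗ ψ_s(y))`, the graph of `φ_s ⊗ ψ_s`. -/
noncomputable def tensorGraph (s : S) :
    Submodule ℂ (E.tensorX F × E.tensorX F) :=
  (Submodule.span ℂ (E.tensorPairs F s)).topologicalClosure

theorem isClosed_tensorGraph (s : S) :
    IsClosed (E.tensorGraph F s : Set (E.tensorX F × E.tensorX F)) :=
  Submodule.isClosed_topologicalClosure _

theorem mk_mem_tensorGraph (s : S) (x : E.bimodule.idealMul (P.action.ideal s⁻¹))
    (y : F.bimodule.idealMul (Q.action.ideal s⁻¹)) :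
    (tmul E.bimodule F.bimodule (x : E.X) (y : F.X),
      tmul E.bimodule F.bimodule (E.map s x : E.X) (F.map s y : F.X)) ∈
      E.tensorGraph F s :=
  Submodule.le_topologicalClosure _ (Submodule.subset_span ⟨x, y, rfl⟩)

variable {F} in
theorem rinner_mem_isoGraph {s : S} (x x' : F.bimodule.idealMul (Q.action.ideal s⁻¹)) :
    (F.bimodule.rinner x x', F.bimodule.rinner (F.map s x) (F.map s x')) ∈
      isoGraph (R.action.aut s) :=
  mk_mem_isoGraph (a := ⟨F.bimodule.rinner x x',
    F.bimodule.rinner_mem_of_mem_left (F.idealMul_eq _ ▸ x.2) _⟩).2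
      ((F.isPartialAut s).map_rinner x x' _ rfl)

variable {F} in
theorem linner_mem_isoGraph {s : S} (x x' : F.bimodule.idealMul (Q.action.ideal s⁻¹)) :
    (F.bimodule.linner x x', F.bimodule.linner (F.map s x) (F.map s x')) ∈
      isoGraph (Q.action.aut s) :=
  mk_mem_isoGraph (a := ⟨F.bimodule.linner x x',
    F.bimodule.linner_mem_of_mem_left x.2 _⟩).2
      ((F.isPartialAut s).map_linner x x' _ rfl)

/-- `φ_s ⊗ ψ_s` intertwines the `C`-valued inner products with `γ_s`: on elementary tensors the
middle factor `⟨x, x'⟩_B` is carried along by `β_s` and absorbed by `ψ_s`. -/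
theorem tensor_rinner_mem_isoGraph {s : S}
    {p q : E.tensorX F × E.tensorX F}
    (hp : p ∈ E.tensorGraph F s) (hq : q ∈ E.tensorGraph F s) :
    ((tensor E.bimodule F.bimodule).rinner p.1 q.1,
      (tensor E.bimodule F.bimodule).rinner p.2 q.2) ∈ isoGraph (R.action.aut s) := by
  refine (tensor E.bimodule F.bimodule).rinner_mem_of_mem_closure_span (isClosed_isoGraph _)
    (star_mem_isoGraph _) ?_ hp hq
  rintro _ ⟨x, y, rfl⟩ _ ⟨x', y', rfl⟩
  obtain ⟨b, hb⟩ := E.rinner_mem_isoGraph x x'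
  rw [Prod.mk.injEq] at hb
  have h := (F.isPartialAut s).map_lsmul y' ⟨_, F.bimodule.lsmul_mem b y'.2⟩ b rfl
  change ((tensorHilbert E.bimodule F.bimodule).rinner
      (tmul E.bimodule F.bimodule (x : E.X) (y : F.X))
      (tmul E.bimodule F.bimodule (x' : E.X) (y' : F.X)),
    (tensorHilbert E.bimodule F.bimodule).rinner
      (tmul E.bimodule F.bimodule (E.map s x : E.X) (F.map s y : F.X))
      (tmul E.bimodule F.bimodule (E.map s x' : E.X) (F.map s y' : F.X))) ∈ _
  rw [rinner_tmul, rinner_tmul, ← hb.1, ← hb.2, ← h]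
  exact F.rinner_mem_isoGraph y ⟨_, F.bimodule.lsmul_mem b y'.2⟩

theorem tensor_linner_mem_isoGraph {s : S}
    {p q : E.tensorX F × E.tensorX F}
    (hp : p ∈ E.tensorGraph F s) (hq : q ∈ E.tensorGraph F s) :
    ((tensor E.bimodule F.bimodule).linner p.1 q.1,
      (tensor E.bimodule F.bimodule).linner p.2 q.2) ∈ isoGraph (P.action.aut s) := by
  refine (tensor E.bimodule F.bimodule).linner_mem_of_mem_closure_span (isClosed_isoGraph _)
    (star_mem_isoGraph _) ?_ hp hq
  rintro _ ⟨x, y, rfl⟩ _ ⟨x', y', rfl⟩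
  obtain ⟨b, hb⟩ := F.linner_mem_isoGraph y y'
  rw [Prod.mk.injEq] at hb
  have h := (E.isPartialAut s).map_rsmul x ⟨_, E.bimodule.rsmul_mem_idealMul b x.2⟩ b rfl
  change ((tensorHilbert E.bimodule F.bimodule).linner
      (tmul E.bimodule F.bimodule (x : E.X) (y : F.X))
      (tmul E.bimodule F.bimodule (x' : E.X) (y' : F.X)),
    (tensorHilbert E.bimodule F.bimodule).linner
      (tmul E.bimodule F.bimodule (E.map s x : E.X) (F.map s y : F.X))
      (tmul E.bimodule F.bimodule (E.map s x' : E.X) (F.map s y' : F.X))) ∈ _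
  rw [linner_tmul, linner_tmul, ← hb.1, ← hb.2, ← h]
  exact E.linner_mem_isoGraph ⟨_, E.bimodule.rsmul_mem_idealMul b x.2⟩ x'

theorem norm_eq_of_mem_tensorGraph {s : S}
    {p : E.tensorX F × E.tensorX F}
    (hp : p ∈ E.tensorGraph F s) : ‖p.2‖ = ‖p.1‖ := by
  have h := norm_eq_of_mem_isoGraph (E.tensor_rinner_mem_isoGraph F hp hp)
  have h2 : ‖p.2‖ ^ 2 = ‖p.1‖ ^ 2 := by
    rw [(tensor E.bimodule F.bimodule).norm_sq_eq_rinner,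
      (tensor E.bimodule F.bimodule).norm_sq_eq_rinner]
    exact h
  exact (sq_eq_sq₀ (norm_nonneg _) (norm_nonneg _)).1 h2

/-- `φ_s ⊗ ψ_s` is single-valued, being isometric. -/
theorem tensorGraph_unique {s : S} {z w w' : E.tensorX F}
    (h : (z, w) ∈ E.tensorGraph F s) (h' : (z, w') ∈ E.tensorGraph F s) : w = w' := by
  have := E.norm_eq_of_mem_tensorGraph F (Submodule.sub_mem _ h h')
  simpa [sub_eq_zero] using this

theorem tensor_idealMul_eq (s : S) :
    (tensor E.bimodule F.bimodule).idealMul (P.action.ideal s) =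
      (tensor E.bimodule F.bimodule).mulIdeal (R.action.ideal s) :=
  (tensor_idealMul_eq_closure_span (E.idealMul_eq s)).trans
    (tensor_mulIdeal_eq_closure_span (E.idealMul_eq s) (F.idealMul_eq s)).symm

theorem exists_mem_tensorGraph_of_mem_source {s : S} {z : E.tensorX F}
    (hz : z ∈ (tensor E.bimodule F.bimodule).idealMul (P.action.ideal s⁻¹)) :
    ∃ w, (z, w) ∈ E.tensorGraph F s := by
  rw [tensor_idealMul_eq_closure_span (E.idealMul_eq _)] at hz
  obtain ⟨p, hp, rfl⟩ := Submodule.exists_mem_topologicalClosure_of_isometric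
    (Submodule.span ℂ (E.tensorPairs F s)) (LinearMap.fst ℂ _ _) (fun p hp => by
      change ‖p.1‖ = max ‖p.1‖ ‖p.2‖
      rw [E.norm_eq_of_mem_tensorGraph F hp, max_self])
    (Submodule.topologicalClosure_mono (Submodule.span_le.2 (by
      rintro _ ⟨x, hx, y, hy, rfl⟩
      exact ⟨_, Submodule.subset_span ⟨⟨x, hx⟩, ⟨y, hy⟩, rfl⟩, rfl⟩)) hz)
  exact ⟨p.2, hp⟩

theorem exists_mem_tensorGraph_of_mem_target {s : S} {w : E.tensorX F}
    (hw : w ∈ (tensor E.bimodule F.bimodule).idealMul (P.action.ideal s)) :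
    ∃ z, (z, w) ∈ E.tensorGraph F s := by
  rw [tensor_idealMul_eq_closure_span (E.idealMul_eq _)] at hw
  obtain ⟨p, hp, rfl⟩ := Submodule.exists_mem_topologicalClosure_of_isometric
    (Submodule.span ℂ (E.tensorPairs F s)) (LinearMap.snd ℂ _ _) (fun p hp => by
      change ‖p.2‖ = max ‖p.1‖ ‖p.2‖
      rw [E.norm_eq_of_mem_tensorGraph F hp, max_self])
    (Submodule.topologicalClosure_mono (Submodule.span_le.2 (by
      rintro _ ⟨x, hx, y, hy, rfl⟩
      obtain ⟨x', hx'⟩ := (E.isPartialAut s).surjective ⟨x, hx⟩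
      obtain ⟨y', hy'⟩ := (F.isPartialAut s).surjective ⟨y, hy⟩
      refine ⟨_, Submodule.subset_span ⟨x', y', rfl⟩, ?_⟩
      rw [hx', hy']
      rfl)) hw)
  exact ⟨p.1, hp⟩

theorem mem_source_of_mem_tensorGraph {s : S}
    {p : E.tensorX F × E.tensorX F}
    (hp : p ∈ E.tensorGraph F s) :
    p.1 ∈ (tensor E.bimodule F.bimodule).idealMul (P.action.ideal s⁻¹) := by
  rw [(tensor E.bimodule F.bimodule).mem_idealMul_iff]
  obtain ⟨a, ha⟩ := E.tensor_linner_mem_isoGraph F hp hp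
  have h : (a : P.Alg) = (ImprimitivityBimodule.tensor E.bimodule F.bimodule).linner p.1 p.1 :=
    congrArg Prod.fst ha
  rw [← h]
  exact a.2

theorem mem_target_of_mem_tensorGraph {s : S}
    {p : E.tensorX F × E.tensorX F}
    (hp : p ∈ E.tensorGraph F s) :
    p.2 ∈ (tensor E.bimodule F.bimodule).idealMul (P.action.ideal s) := by
  rw [(tensor E.bimodule F.bimodule).mem_idealMul_iff]
  obtain ⟨a, ha⟩ := E.tensor_linner_mem_isoGraph F hp hp
  have h : (P.action.aut s a : P.Alg) =
      (ImprimitivityBimodule.tensor E.bimodule F.bimodule).linner p.2 p.2 :=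
    congrArg Prod.snd ha
  rw [← h]
  exact Subtype.mem _

theorem lsmul_mem_tensorGraph {s : S}
    {p : E.tensorX F × E.tensorX F}
    (hp : p ∈ E.tensorGraph F s) (a : (P.action.ideal s⁻¹).Elem) :
    ((tensor E.bimodule F.bimodule).lsmul a p.1,
      (tensor E.bimodule F.bimodule).lsmul (P.action.aut s a) p.2) ∈ E.tensorGraph F s := by
  let L := ((tensor E.bimodule F.bimodule).lsmulL a).prodMap
    ((tensor E.bimodule F.bimodule).lsmulL (P.action.aut s a))
  refine Submodule.topologicalClosure_span_le (N := (E.tensorGraph F s).comap L.toLinearMap)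
    ((E.isClosed_tensorGraph F s).preimage L.continuous) ?_ hp
  rintro _ ⟨x, y, rfl⟩
  have h := (E.isPartialAut s).map_lsmul x ⟨_, E.bimodule.lsmul_mem a x.2⟩ a rfl
  have := E.mk_mem_tensorGraph F s ⟨_, E.bimodule.lsmul_mem a x.2⟩ y
  rw [h, ← lsmul_tmul, ← lsmul_tmul] at this
  exact this

theorem rsmul_mem_tensorGraph {s : S}
    {p : E.tensorX F × E.tensorX F}
    (hp : p ∈ E.tensorGraph F s) (c : (R.action.ideal s⁻¹).Elem) :
    ((tensor E.bimodule F.bimodule).rsmul p.1 c,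
      (tensor E.bimodule F.bimodule).rsmul p.2 (R.action.aut s c)) ∈ E.tensorGraph F s := by
  let L := ((tensor E.bimodule F.bimodule).rsmulL.flip c).prodMap
    ((tensor E.bimodule F.bimodule).rsmulL.flip (R.action.aut s c))
  refine Submodule.topologicalClosure_span_le (N := (E.tensorGraph F s).comap L.toLinearMap)
    ((E.isClosed_tensorGraph F s).preimage L.continuous) ?_ hp
  rintro _ ⟨x, y, rfl⟩
  have h := (F.isPartialAut s).map_rsmul y ⟨_, F.bimodule.rsmul_mem_idealMul c y.2⟩ c rfl
  have := E.mk_mem_tensorGraph F s x ⟨_, F.bimodule.rsmul_mem_idealMul c y.2⟩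
  rw [h, ← rsmul_tmul, ← rsmul_tmul] at this
  exact this

/-- The map `φ_s ⊗ ψ_s`. -/
noncomputable def tensorMap (s : S)
    (z : (tensor E.bimodule F.bimodule).idealMul (P.action.ideal s⁻¹)) :
    (tensor E.bimodule F.bimodule).idealMul (P.action.ideal s) :=
  ⟨(E.exists_mem_tensorGraph_of_mem_source F z.2).choose,
    E.mem_target_of_mem_tensorGraph F (E.exists_mem_tensorGraph_of_mem_source F z.2).choose_spec⟩

theorem tensorMap_mem_tensorGraph (s : S)
    (z : (tensor E.bimodule F.bimodule).idealMul (P.action.ideal s⁻¹)) :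
    ((z : E.tensorX F), (E.tensorMap F s z : E.tensorX F)) ∈
      E.tensorGraph F s :=
  (E.exists_mem_tensorGraph_of_mem_source F z.2).choose_spec

theorem tensorMap_isPartialAut (s : S) :
    (tensor E.bimodule F.bimodule).IsPartialAut (P.action.aut s) (E.tensorMap F s)
      (R.action.aut s) where
  source := (tensor E.bimodule F.bimodule).isSubbimodule (E.tensor_idealMul_eq F _)
  target := (tensor E.bimodule F.bimodule).isSubbimodule (E.tensor_idealMul_eq F _)
  map_rsmul z w c h := by
    refine E.tensorGraph_unique F (E.tensorMap_mem_tensorGraph F s w) ?_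
    rw [h]
    exact E.rsmul_mem_tensorGraph F (E.tensorMap_mem_tensorGraph F s z) c
  map_rinner z w c h := by
    refine mk_mem_isoGraph.1 ?_
    rw [h]
    exact E.tensor_rinner_mem_isoGraph F (E.tensorMap_mem_tensorGraph F s z)
      (E.tensorMap_mem_tensorGraph F s w)
  map_lsmul z w a h := by
    refine E.tensorGraph_unique F (E.tensorMap_mem_tensorGraph F s w) ?_
    rw [h]
    exact E.lsmul_mem_tensorGraph F (E.tensorMap_mem_tensorGraph F s z) a
  map_linner z w a h := by
    refine mk_mem_isoGraph.1 ?_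
    rw [h]
    exact E.tensor_linner_mem_isoGraph F (E.tensorMap_mem_tensorGraph F s z)
      (E.tensorMap_mem_tensorGraph F s w)
  surjective w := by
    obtain ⟨z, hz⟩ := E.exists_mem_tensorGraph_of_mem_target F w.2
    refine ⟨⟨z, E.mem_source_of_mem_tensorGraph F hz⟩, Subtype.ext ?_⟩
    exact E.tensorGraph_unique F (E.tensorMap_mem_tensorGraph F s _) hz

/-- Twisted multiplicativity on elementary tensors: with `φ_s φ_t x = u · (φ_{st} x · v*)` and
`ψ_s ψ_t y = (v · ψ_{st} y) · w*`, the multiplier `v` cancels in the tensor product. -/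
theorem lsmul_rsmul_tmul_map_map (s t : S) (x : E.X) (y : F.X)
    (hx : x ∈ E.bimodule.idealMul (P.action.ideal t⁻¹))
    (hx' : (E.map t ⟨x, hx⟩ : E.X) ∈ E.bimodule.idealMul (P.action.ideal s⁻¹))
    (hx'' : x ∈ E.bimodule.idealMul (P.action.ideal (s * t)⁻¹))
    (hy : y ∈ F.bimodule.idealMul (Q.action.ideal t⁻¹))
    (hy' : (F.map t ⟨y, hy⟩ : F.X) ∈ F.bimodule.idealMul (Q.action.ideal s⁻¹))
    (hy'' : y ∈ F.bimodule.idealMul (Q.action.ideal (s * t)⁻¹))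
    (a : (P.action.ideal (s * t)).Elem) (c : (R.action.ideal (s * t)).Elem) :
    (tensor E.bimodule F.bimodule).lsmul a ((tensor E.bimodule F.bimodule).rsmul
      (tmul E.bimodule F.bimodule (E.map s ⟨E.map t ⟨x, hx⟩, hx'⟩ : E.X)
        (F.map s ⟨F.map t ⟨y, hy⟩, hy'⟩ : F.X)) c) =
    (tensor E.bimodule F.bimodule).lsmul
      (mulRight a (P.action.cocycle s t : (P.action.ideal (s * t)).Mult))
      ((tensor E.bimodule F.bimodule).rsmul
        (tmul E.bimodule F.bimodule (E.map (s * t) ⟨x, hx''⟩ : E.X)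
          (F.map (s * t) ⟨y, hy''⟩ : F.X))
        (mulLeft (star (R.action.cocycle s t : (R.action.ideal (s * t)).Mult)) c)) := by
  obtain ⟨x₁, hx₁, hx₂⟩ := E.comp_eq s t x hx hx' hx''
  obtain ⟨y₁, hy₁, hy₂⟩ := F.comp_eq s t y hy hy' hy''
  obtain ⟨x₃, hx₃, hx₄⟩ := E.bimodule.exists_isRightMultiple_isLeftMultiple
    (n := star (Q.action.cocycle s t)) (E.idealMul_eq _) hx₁ hx₂
  rw [← tmul_eq_of_isMultiple (v := Q.action.cocycle s t) hx₃ hy₁]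
  change (tensorHilbert E.bimodule F.bimodule).lsmul a
      ((tensorHilbert E.bimodule F.bimodule).rsmul (tmul E.bimodule F.bimodule _ _) c) =
    (tensorHilbert E.bimodule F.bimodule).lsmul _
      ((tensorHilbert E.bimodule F.bimodule).rsmul (tmul E.bimodule F.bimodule _ _) _)
  rw [rsmul_tmul, rsmul_tmul, lsmul_tmul, lsmul_tmul, hx₄.2.2, hy₂.2.2]

/-- Twisted multiplicativity of the maps `φ_s ⊗ ψ_s` on elementary tensors, in terms of their
graphs. -/
theorem exists_tensorGraph_comp (s t : S) (a : (P.action.ideal (s * t)).Elem)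
    (c : (R.action.ideal (s * t)).Elem) (z : E.tensorX F)
    (hz : z ∈ {z | ∃ x ∈ E.bimodule.idealMul (P.action.ideal (s * t)⁻¹),
      ∃ y ∈ F.bimodule.idealMul (Q.action.ideal (s * t)⁻¹),
      z = tmul E.bimodule F.bimodule x y}) :
    ∃ x y w, (z, x) ∈ E.tensorGraph F t ∧ (x, y) ∈ E.tensorGraph F s ∧
      (z, w) ∈ E.tensorGraph F (s * t) ∧
      (tensor E.bimodule F.bimodule).lsmul a ((tensor E.bimodule F.bimodule).rsmul y c) =
        (tensor E.bimodule F.bimodule).lsmul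
          (mulRight a (P.action.cocycle s t : (P.action.ideal (s * t)).Mult))
          ((tensor E.bimodule F.bimodule).rsmul w
            (mulLeft (star (R.action.cocycle s t : (R.action.ideal (s * t)).Mult)) c)) := by
  obtain ⟨x, hx'', y, hy'', rfl⟩ := hz
  obtain ⟨hx, hx'⟩ := (E.mem_domain_comp s t x).2 hx''
  obtain ⟨hy, hy'⟩ := (F.mem_domain_comp s t y).2 hy''
  exact ⟨_, _, _, E.mk_mem_tensorGraph F t ⟨x, hx⟩ ⟨y, hy⟩,
    E.mk_mem_tensorGraph F s ⟨_, hx'⟩ ⟨_, hy'⟩, E.mk_mem_tensorGraph F (s * t) ⟨_, hx''⟩ ⟨_, hy''⟩,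
    E.lsmul_rsmul_tmul_map_map F s t x y hx hx' hx'' hy hy' hy'' a c⟩

theorem tensorMap_comp (s t : S) (z : E.tensorX F)
    (h : z ∈ (tensor E.bimodule F.bimodule).idealMul (P.action.ideal t⁻¹))
    (h' : (E.tensorMap F t ⟨z, h⟩ : E.tensorX F) ∈
      (tensor E.bimodule F.bimodule).idealMul (P.action.ideal s⁻¹))
    (h'' : z ∈ (tensor E.bimodule F.bimodule).idealMul (P.action.ideal (s * t)⁻¹))
    (a : (P.action.ideal (s * t)).Elem) (c : (R.action.ideal (s * t)).Elem) :
    (tensor E.bimodule F.bimodule).lsmul a ((tensor E.bimodule F.bimodule).rsmul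
      (E.tensorMap F s ⟨E.tensorMap F t ⟨z, h⟩, h'⟩ : E.tensorX F) c) =
    (tensor E.bimodule F.bimodule).lsmul
      (mulRight a (P.action.cocycle s t : (P.action.ideal (s * t)).Mult))
      ((tensor E.bimodule F.bimodule).rsmul (E.tensorMap F (s * t) ⟨z, h''⟩ : E.tensorX F)
        (mulLeft (star (R.action.cocycle s t : (R.action.ideal (s * t)).Mult)) c)) := by
  let K := ImprimitivityBimodule.tensor E.bimodule F.bimodule
  let L := (K.lsmulL a).comp (K.rsmulL.flip c)
  let L' := (K.lsmulL (mulRight a (P.action.cocycle s t : (P.action.ideal (s * t)).Mult))).comp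
    (K.rsmulL.flip (mulLeft (star (R.action.cocycle s t : (R.action.ideal (s * t)).Mult)) c))
  have hz := h''
  rw [tensor_idealMul_eq_closure_span (E.idealMul_eq _)] at hz
  obtain ⟨x, y, w, h₁, h₂, h₃, h₄⟩ := Submodule.exists_comp_of_mem_closure_span
    (E.isClosed_tensorGraph F t) (E.isClosed_tensorGraph F s) (E.isClosed_tensorGraph F (s * t))
    (fun _ => E.norm_eq_of_mem_tensorGraph F) (fun _ => E.norm_eq_of_mem_tensorGraph F)
    (fun _ => E.norm_eq_of_mem_tensorGraph F) L L' (E.exists_tensorGraph_comp F s t a c) hz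
  obtain rfl := E.tensorGraph_unique F (E.tensorMap_mem_tensorGraph F t ⟨z, h⟩) h₁
  obtain rfl := E.tensorGraph_unique F (E.tensorMap_mem_tensorGraph F s ⟨_, h'⟩) h₂
  obtain rfl := E.tensorGraph_unique F (E.tensorMap_mem_tensorGraph F (s * t) ⟨z, h''⟩) h₃
  exact h₄

/-- The balanced tensor product of two Morita equivalences. -/
noncomputable def tensor : TwistedMoritaEquivalence P R :=
  .ofPartialAut (ImprimitivityBimodule.tensor E.bimodule F.bimodule) (E.tensor_idealMul_eq F)
    (E.tensorMap F) (E.tensorMap_isPartialAut F) (E.tensorMap_comp F)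

theorem tensor_isTensorProduct : (E.tensor F).IsTensorProduct E F := by
  refine ⟨tmul E.bimodule F.bimodule, closure_span_tmul, tmul_rsmul, lsmul_tmul, rsmul_tmul,
    rinner_tmul, fun s x y => ?_⟩
  have h := E.mk_mem_tensorGraph F s x y
  exact ⟨E.mem_source_of_mem_tensorGraph F h,
    E.tensorGraph_unique F (E.tensorMap_mem_tensorGraph F s _) h⟩

end TwistedMoritaEquivalence

theorem mainTheorem4 {S : Type v} [InverseMonoid S] :
    Equivalence (fun P Q : TwistedSystem.{u, v} S => TwistedMoritaEquivalent P Q) ∧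
    (∀ (P Q : TwistedSystem.{u, v} S) (E : TwistedMoritaEquivalence P Q),
      ∃ E' : TwistedMoritaEquivalence Q P, E'.IsReverse E) ∧
    (∀ (P Q R : TwistedSystem.{u, v} S) (E : TwistedMoritaEquivalence P Q) (F : TwistedMoritaEquivalence Q R),
      ∃ G : TwistedMoritaEquivalence P R, G.IsTensorProduct E F) := by
  refine ⟨⟨fun P => ⟨.refl P⟩, fun ⟨E⟩ => ⟨E.reverse⟩, fun ⟨E⟩ ⟨F⟩ => ⟨E.tensor F⟩⟩,
    fun P Q E => ⟨E.reverse, E.reverse_isReverse⟩,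
    fun P Q R E F => ⟨E.tensor F, E.tensor_isTensorProduct F⟩⟩
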